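/- **Setting.** Let $d_1=\tfrac12(1,-\sqrt3)$, $d_2=\tfrac12(1,\sqrt3)$, $d_3=(-1,0)$, $a_1=d_2-d_3$, $a_2=d_3-d_1$, $a_3=d_1-d_2$, let $\Gamma=\mathrm{Span}_{\mathbb Z}\{a_1,a_2,a_3\}$, let $\mathcal C=\Gamma\cup(\Gamma+d_3)$ be the honeycomb structure and $\mathcal H=\ell^2(\mathcal C)\otimes\mathbb C^2$. Let $\sigma_x,\sigma_y,\sigma_z$ be the Pauli matrices acting on $\mathbb C^2$ and $S_z=\tfrac12\sigma_z$. Let $(T_\gamma\psi)(x)=\psi(x-\gamma)$ for $\gamma\in\Gamma$; $(R_{2\pi/3}\psi)(x)=e^{-i\frac{2\pi}{3}S_z}\psi(\mathrm R^{-1}x)$ with $\mathrm R$ the counterclockwise rotation of the plane by $2\pi/3$; $(R_{v\otimes h}\psi)(x_1,x_2)=-i\sigma_y\psi(x_1,-x_2)$; $(\Theta\psi)(x)=i\sigma_y\overline{\psi(x)}$; $(\Xi\psi)(x)=\sigma_x\overline{\psi(x)}$. A bounded operator $A$ on $\mathcal H$ is *periodic* if $[A,T_\gamma]=0$ for all $\gamma\in\Gamma$.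 It is *short-range* if there are $C,\xi>0$ with $|A_{n,m}|\le Ce^{-|n-m|_1/\xi}$ for all $n,m\in\mathbb Z^2$, where $A_{n,m}$ is the $4\times4$ block of matrix elements of $A$ between the sites $\{n_1a_1+n_2a_2,\ n_1a_1+n_2a_2+d_3\}$ and the sites $\{m_1a_1+m_2a_2,\ m_1a_1+m_2a_2+d_3\}$. The class $\mathrm{AII}^{\hexagon}$ consists of the periodic bounded operators $H$ with $[H,R_{2\pi/3}]=[H,R_{v\otimes h}]=[H,\Theta]=0$ and $H\Xi+\Xi H\neq0$. An *insulator* is a pair $(H,\mu)$ with $H$ bounded and self-adjoint, $\mu\in\mathbb R$, and $\mu\notin\sigma(H)$ (that is, $\mu$ lies in a gap of the spectrum). Its Fermi projection is $P=\chi_{(-\infty,\mu]}(H)$. Let $X_i$ ($i=1,2$) be the $i$-th position operator on its maximal domain, and for $\eta>0$ let $$L_{\eta,j}=i\int_{-\infty}^0 e^{\eta s}\,e^{isH}[X_j,P]e^{-isH}\,ds ,$$ where $[X_j,P]$ denotes the bounded extension of the commutator. The conventional and the proper spin current operators are, on their natural domains, $$J_i^{\mathrm{conv}}=\tfrac i2[H,X_i]S_z+\tfrac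 i2S_z[H,X_i],\qquad J_i^{\mathrm{prop}}=i[H,X_iS_z].$$ The trace per unit volume is $\tau(A)=\lim_{L\to\infty,\ L\ \mathrm{odd}}\frac1{|C_L|}\mathrm{Tr}(\chi_LA\chi_L)$, where $C_L=\{x\in\mathcal C: x=\alpha_1a_1+\alpha_2a_2,\ |\alpha_1|,|\alpha_2|\le L/2\}$, $|C_L|$ is its number of points, and $\chi_L$ is multiplication by its characteristic function. The spin conductivities are, for $i,j\in\{1,2\}$, $$\sigma_{ij}^{\mathrm s,\sharp}=\lim_{\eta\to0^+}\mathrm{Re}\,\tau\big(J_i^\sharp L_{\eta,j}\big),\qquad \sharp\in\{\mathrm{conv},\mathrm{prop}\}.$$ **Proposition.** Let $(H,\mu)$ be an insulator with $H$ short-range and $H\in\mathrm{AII}^{\hexagon}$. Then, for all $i,j\in\{1,2\}$, $\sigma^{\mathrm s,\mathrm{conv}}_{ij}$ and $\sigma^{\mathrm s,\mathrm{prop}}_{ij}$ are well defined (the commutator $[X_j,P]$ is densely defined and extends to a bounded operator, the traces per unit volume exist for every $\eta>0$, and the limits $\eta\to0^+$ exist) and they coincide; denote their common value by $\sigma^{\mathrm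 s}_{ij}$. The tensor $\sigma^{\mathrm s}$ is antisymmetric: $$\sigma^{\mathrm s}=\begin{pmatrix}0&\sigma^{\mathrm s}_{12}\\-\sigma^{\mathrm s}_{12}&0\end{pmatrix}.$$ -/

import Mathlib

open scoped Topology

noncomputable section

namespace SpinHall

/-! ### The honeycomb structure -/

/-- The plane (only its vector space structure is used). -/
abbrev Plane : Type := Fin 2 → ℝ

/-- Nearest-neighbour vectors. -/
def d₁ : Plane := ![1 / 2, -(√3 / 2)]
def d₂ : Plane := ![1 / 2, √3 / 2]
def d₃ : Plane := ![-1, 0]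

/-- Next-to-nearest-neighbour vectors. -/
def a₁ : Plane := d₂ - d₃
def a₂ : Plane := d₃ - d₁
def a₃ : Plane := d₁ - d₂

/-- The Bravais lattice. -/
def bravais : Submodule ℤ Plane := Submodule.span ℤ {a₁, a₂, a₃}

/-- The honeycomb structure `Γ ∪ (Γ + d₃)`. -/
def honeycomb : Set Plane := {x | x ∈ bravais ∨ x - d₃ ∈ bravais}

/-- The points of the honeycomb structure. -/
abbrev Site : Type := {x : Plane // x ∈ honeycomb}

lemma a₁_mem : a₁ ∈ bravais := Submodule.subset_span (by simp)
lemma a₂_mem : a₂ ∈ bravais := Submodule.subset_span (by simp)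
lemma a₃_mem : a₃ ∈ bravais := Submodule.subset_span (by simp)

lemma add_mem_honeycomb {γ x : Plane} (hγ : γ ∈ bravais) (hx : x ∈ honeycomb) :
    x + γ ∈ honeycomb := by
  rcases hx with h | h
  · exact Or.inl (add_mem h hγ)
  · refine Or.inr ?_
    have : x + γ - d₃ = (x - d₃) + γ := by abel
    rw [this]
    exact add_mem h hγ

/-- The translation `x ↦ x + γ` of the honeycomb structure by a lattice vector. -/
def shift (γ : bravais) : Equiv.Perm Site where
  toFun x := ⟨x.1 + γ.1, add_mem_honeycomb γ.2 x.2⟩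
  invFun x := ⟨x.1 + -γ.1, add_mem_honeycomb (neg_mem γ.2) x.2⟩
  left_inv x := by ext1; simp
  right_inv x := by ext1; simp

/-- A linear map that preserves the lattice and moves `d₃` by a lattice vector
preserves the honeycomb structure. -/
lemma map_mem_honeycomb (f : Plane →ₗ[ℝ] Plane) (h₁ : f a₁ ∈ bravais) (h₂ : f a₂ ∈ bravais)
    (h₃ : f a₃ ∈ bravais) (hd : f d₃ - d₃ ∈ bravais) {x : Plane} (hx : x ∈ honeycomb) :
    f x ∈ honeycomb := by
  have key : ∀ γ ∈ bravais, f γ ∈ bravais := by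
    intro γ hγ
    have hle : bravais ≤ bravais.comap (f.restrictScalars ℤ) := by
      refine Submodule.span_le.2 ?_
      rintro y (rfl | rfl | rfl)
      exacts [h₁, h₂, h₃]
    exact hle hγ
  rcases hx with h | h
  · exact Or.inl (key _ h)
  · refine Or.inr ?_
    have : f x - d₃ = f (x - d₃) + (f d₃ - d₃) := by rw [map_sub]; abel
    rw [this]
    exact add_mem (key _ h) hd

/-- Counterclockwise rotation of the plane by `2π/3`. -/
def rot : Plane →ₗ[ℝ] Plane := Matrix.mulVecLin !![-(1 / 2), -(√3 / 2); √3 / 2, -(1 / 2)]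

/-- Vertical reflection `(x₁, x₂) ↦ (x₁, -x₂)` of the plane. -/
def refl : Plane →ₗ[ℝ] Plane := Matrix.mulVecLin !![1, 0; 0, -1]

lemma rot_apply (x : Plane) :
    rot x = ![-(1 / 2) * x 0 - √3 / 2 * x 1, √3 / 2 * x 0 - 1 / 2 * x 1] := by
  ext i; fin_cases i <;> simp [rot, Matrix.mulVec, dotProduct] <;> ring

lemma refl_apply (x : Plane) : refl x = ![x 0, -x 1] := by
  ext i; fin_cases i <;> simp [refl, Matrix.mulVec, dotProduct]

lemma rot_a₁ : rot a₁ = a₂ := by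
  have h : √3 * √3 = 3 := Real.mul_self_sqrt (by norm_num)
  ext i; fin_cases i <;> simp [rot_apply, a₁, a₂, d₁, d₂, d₃] <;> nlinarith

lemma rot_a₂ : rot a₂ = a₃ := by
  have h : √3 * √3 = 3 := Real.mul_self_sqrt (by norm_num)
  ext i; fin_cases i <;> simp [rot_apply, a₂, a₃, d₁, d₂, d₃] <;> nlinarith

lemma rot_a₃ : rot a₃ = a₁ := by
  have h : √3 * √3 = 3 := Real.mul_self_sqrt (by norm_num)
  ext i; fin_cases i <;> simp [rot_apply, a₁, a₃, d₁, d₂, d₃] <;> nlinarith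

lemma rot_d₃ : rot d₃ - d₃ = -a₂ := by
  ext i; fin_cases i <;> simp [rot_apply, a₂, d₁, d₃]

lemma rot_rot_rot (x : Plane) : rot (rot (rot x)) = x := by
  have h : √3 * √3 = 3 := Real.mul_self_sqrt (by norm_num)
  ext i; fin_cases i <;> simp [rot_apply]
  · linear_combination (3 / 8 * x 0 + √3 / 8 * x 1) * h
  · linear_combination (-(√3 / 8) * x 0 + 3 / 8 * x 1) * h

lemma refl_a₁ : refl a₁ = -a₂ := by
  ext i; fin_cases i <;> simp [refl_apply, a₁, a₂, d₁, d₂, d₃]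

lemma refl_a₂ : refl a₂ = -a₁ := by
  ext i; fin_cases i <;> simp [refl_apply, a₁, a₂, d₁, d₂, d₃]; norm_num

lemma refl_a₃ : refl a₃ = -a₃ := by
  ext i; fin_cases i <;> simp [refl_apply, a₃, d₁, d₂]

lemma refl_d₃ : refl d₃ - d₃ = 0 := by
  ext i; fin_cases i <;> simp [refl_apply, d₃]

lemma refl_refl (x : Plane) : refl (refl x) = x := by
  ext i; fin_cases i <;> simp [refl_apply]

lemma rot_mem {x : Plane} (hx : x ∈ honeycomb) : rot x ∈ honeycomb :=
  map_mem_honeycomb rot (rot_a₁ ▸ a₂_mem) (rot_a₂ ▸ a₃_mem) (rot_a₃ ▸ a₁_mem)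
    (rot_d₃ ▸ neg_mem a₂_mem) hx

lemma refl_mem {x : Plane} (hx : x ∈ honeycomb) : refl x ∈ honeycomb :=
  map_mem_honeycomb refl (refl_a₁ ▸ neg_mem a₂_mem) (refl_a₂ ▸ neg_mem a₁_mem)
    (refl_a₃ ▸ neg_mem a₃_mem) (refl_d₃ ▸ zero_mem _) hx

/-- The rotation by `2π/3` as a bijection of the honeycomb structure. -/
def rotSite : Equiv.Perm Site where
  toFun x := ⟨rot x.1, rot_mem x.2⟩
  invFun x := ⟨rot (rot x.1), rot_mem (rot_mem x.2)⟩
  left_inv x := Subtype.ext (rot_rot_rot x.1)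
  right_inv x := Subtype.ext (rot_rot_rot x.1)

/-- The vertical reflection as a bijection of the honeycomb structure. -/
def reflSite : Equiv.Perm Site where
  toFun x := ⟨refl x.1, refl_mem x.2⟩
  invFun x := ⟨refl x.1, refl_mem x.2⟩
  left_inv x := Subtype.ext (refl_refl x.1)
  right_inv x := Subtype.ext (refl_refl x.1)

/-- The point `n₁ a₁ + n₂ a₂ + [c]` of the honeycomb structure, with `[0] = 0` and `[1] = d₃`. -/
def site (n : ℤ × ℤ) (c : Fin 2) : Site :=
  ⟨n.1 • a₁ + n.2 • a₂ + (if c = 0 then 0 else d₃), by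
    have h : n.1 • a₁ + n.2 • a₂ ∈ bravais :=
      add_mem (bravais.smul_mem _ a₁_mem) (bravais.smul_mem _ a₂_mem)
    by_cases hc : c = 0
    · rw [if_pos hc, add_zero]
      exact Or.inl h
    · rw [if_neg hc]
      refine Or.inr ?_
      rwa [add_sub_cancel_right]⟩

/-! ### Insulators and their linear response, on an arbitrary complex Hilbert space -/

section Hilbert

variable {E : Type*} [NormedAddCommGroup E] [InnerProductSpace ℂ E] [CompleteSpace E]

/-- `(H, μ)` is an insulator: `H` is self-adjoint and `μ` is in a gap of its spectrum. -/
structure IsInsulator (H : E →L[ℂ] E) (μ : ℝ) : Prop where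
  selfAdjoint : IsSelfAdjoint H
  gap : (μ : ℂ) ∉ spectrum ℂ H

/-- The Fermi projection `χ_{(-∞, μ]}(H)`. For an insulator the function `χ_{(-∞, μ]}` is
continuous on the spectrum of `H`, so this is an instance of the continuous functional calculus. -/
def fermi (H : E →L[ℂ] E) (μ : ℝ) : E →L[ℂ] E :=
  cfc (fun t : ℝ => if t ≤ μ then (1 : ℝ) else 0) H

/-- The operator `i ∫_{-∞}^0 e^{ηs} e^{isH} K e^{-isH} ds`, which is the linear response
`L_{η,j}` of the Fermi projection `P` for `K = [X_j, P]`. -/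
def linearResponse (H K : E →L[ℂ] E) (η : ℝ) : E →L[ℂ] E :=
  Complex.I • ∫ s in Set.Iic (0 : ℝ), Real.exp (η * s) •
    (NormedSpace.exp ((Complex.I * (s : ℂ)) • H) * K *
      NormedSpace.exp (-(Complex.I * (s : ℂ)) • H))

end Hilbert

/-! ### The Hilbert space and the symmetry operators -/

/-- The spin space `ℂ²`; the index `0` is spin up and the index `1` is spin down. -/
abbrev Spin : Type := EuclideanSpace ℂ (Fin 2)

/-- The Hilbert space `ℓ²(C) ⊗ ℂ² = ℓ²(C; ℂ²)`. -/
abbrev Hil : Type := lp (fun _ : Site => Spin) 2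

/-- The bounded linear operators. -/
abbrev Op : Type := Hil →L[ℂ] Hil

open Classical in
/-- The canonical orthonormal basis vector at the point `x` with spin `s`. -/
def δ (x : Site) (s : Fin 2) : Hil := lp.single 2 x (EuclideanSpace.single s (1 : ℂ))

lemma memℓp_twist (M : Spin →L[ℂ] Spin) (e : Equiv.Perm Site) (ψ : Hil) :
    Memℓp (fun x => M (ψ (e.symm x))) 2 := by
  have h := (lp.memℓp ψ).summable (by norm_num)
  have h' := (e.symm.summable_iff (f := fun x => ‖ψ x‖ ^ (2 : ENNReal).toReal)).2 h
  refine memℓp_gen (Summable.of_nonneg_of_le (fun x => by positivity) (fun x => ?_)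
    (h'.mul_left (‖M‖ ^ (2 : ENNReal).toReal)))
  rw [Function.comp, ← Real.mul_rpow (norm_nonneg _) (norm_nonneg _)]
  exact Real.rpow_le_rpow (norm_nonneg _) (M.le_opNorm _) (by norm_num)

/-- The bounded operator `(twist M e ψ)(x) = M ψ(e⁻¹ x)`. -/
def twist (M : Matrix (Fin 2) (Fin 2) ℂ) (e : Equiv.Perm Site) : Op :=
  LinearMap.mkContinuous
    { toFun := fun ψ =>
        ⟨fun x => Matrix.toEuclideanCLM (𝕜 := ℂ) M (ψ (e.symm x)), memℓp_twist _ e ψ⟩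
      map_add' := fun ψ φ => by ext1; funext x; simp; rfl
      map_smul' := fun c ψ => by ext1; funext x; simp }
    ‖Matrix.toEuclideanCLM (𝕜 := ℂ) M‖
    (fun ψ => by
      have hp : 0 < (2 : ENNReal).toReal := by norm_num
      have h := lp.hasSum_norm hp ψ
      have h' := (e.symm.hasSum_iff (f := fun x => ‖ψ x‖ ^ (2 : ENNReal).toReal)).2 h
      refine lp.norm_le_of_forall_sum_le hp
        (mul_nonneg (norm_nonneg _) (lp.norm_nonneg' ψ)) (fun s => ?_)
      rw [Real.mul_rpow (norm_nonneg _) (lp.norm_nonneg' ψ)]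
      have hs := sum_le_hasSum s
        (fun x _ => mul_nonneg (Real.rpow_nonneg (norm_nonneg _) _)
          (Real.rpow_nonneg (norm_nonneg _) _))
        (h'.mul_left (‖Matrix.toEuclideanCLM (𝕜 := ℂ) M‖ ^ (2 : ENNReal).toReal))
      refine (Finset.sum_le_sum (fun x _ => ?_)).trans hs
      rw [← Real.mul_rpow (norm_nonneg _) (norm_nonneg _)]
      exact Real.rpow_le_rpow (norm_nonneg _) (ContinuousLinearMap.le_opNorm _ _) (by norm_num))

lemma twist_apply (M : Matrix (Fin 2) (Fin 2) ℂ) (e : Equiv.Perm Site) (ψ : Hil) (x : Site) :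
    twist M e ψ x = Matrix.toEuclideanCLM (𝕜 := ℂ) M (ψ (e.symm x)) := rfl

/-- Complex conjugation `(K ψ)(x) = conj (ψ(x))`. -/
def conjugation (ψ : Hil) : Hil :=
  ⟨fun x => WithLp.toLp 2 (fun s => star (ψ x s)), by
    refine (lp.memℓp ψ).mono' (fun x => le_of_eq ?_)
    simp [EuclideanSpace.norm_eq]⟩

/-- The Pauli matrices. -/
def pauliX : Matrix (Fin 2) (Fin 2) ℂ := !![0, 1; 1, 0]
def pauliY : Matrix (Fin 2) (Fin 2) ℂ := !![0, -Complex.I; Complex.I, 0]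
def pauliZ : Matrix (Fin 2) (Fin 2) ℂ := !![1, 0; 0, -1]

/-- The spin operator in the direction `z`. -/
def Sz : Op := twist ((1 / 2 : ℂ) • pauliZ) (Equiv.refl Site)

/-- Translation by a lattice vector: `(T_γ ψ)(x) = ψ(x - γ)`. -/
def T (γ : bravais) : Op := twist 1 (shift γ)

/-- The `2π/3`-rotation operator `(R ψ)(x) = exp(-i (2π/3) S_z) ψ(R⁻¹ x)`;
the matrix of `exp(-i (2π/3) σ_z / 2)` is `diag(exp(-iπ/3), exp(iπ/3))`. -/
def Rrot : Op :=
  twist !![Complex.exp (-(Complex.I * (Real.pi / 3))), 0; 0, Complex.exp (Complex.I * (Real.pi / 3))]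
    rotSite

/-- The spatial-vertical and spin-horizontal reflection `(R ψ)(x) = -i σ_y ψ(R_v⁻¹ x)`. -/
def Rvh : Op := twist (-Complex.I • pauliY) reflSite

/-- The time-reversal operator `(Θ ψ)(x) = i σ_y conj (ψ(x))`. -/
def timeReversal (ψ : Hil) : Hil :=
  twist (Complex.I • pauliY) (Equiv.refl Site) (conjugation ψ)

/-- The particle-hole operator `(Ξ ψ)(x) = σ_x conj (ψ(x))`. -/
def particleHole (ψ : Hil) : Hil := twist pauliX (Equiv.refl Site) (conjugation ψ)

/-! ### Classes of operators -/

/-- `Γ`-periodic operators. -/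
def IsPeriodic (A : Op) : Prop := ∀ γ : bravais, Commute A (T γ)

/-- Short-range operators: exponential decay, in the `ℓ¹`-distance of the cells `n` and `m`, of the
`4 × 4` blocks `A_{n,m}`. All norms of a `4 × 4` matrix being equivalent, the decay is
required of the entries. -/
def IsShortRange (A : Op) : Prop :=
  ∃ C ξ : ℝ, 0 < C ∧ 0 < ξ ∧ ∀ (n m : ℤ × ℤ) (c c' s s' : Fin 2),
    ‖inner ℂ (δ (site n c) s) (A (δ (site m c') s'))‖ ≤
      C * Real.exp (-((|n.1 - m.1| + |n.2 - m.2| : ℤ) : ℝ) / ξ)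

/-- The class `AII^hexagon`: periodic operators that are symmetric under the `2π/3`-rotation, the
`v⊗h`-reflection and time reversal, but not particle-hole symmetric. -/
structure IsAIIHex (H : Op) : Prop where
  periodic : IsPeriodic H
  rotation : Commute H Rrot
  reflection : Commute H Rvh
  time_reversal : ∀ ψ, H (timeReversal ψ) = timeReversal (H ψ)
  not_particle_hole : ¬ ∀ ψ, H (particleHole ψ) + particleHole (H ψ) = 0

/-! ### Unbounded operators, with their natural domains -/

/-- Linear operators on a subspace of the Hilbert space. -/
abbrev POp : Type := Hil →ₗ.[ℂ] Hil

/-- A bounded operator, as an everywhere defined one. -/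
def bdd (A : Op) : POp := (A : Hil →ₗ[ℂ] Hil).toPMap ⊤

/-- The product `A B` on its natural domain `{ψ ∈ D(B) | B ψ ∈ D(A)}`. -/
def pmul (A B : POp) : POp :=
  A.comp (B.domRestrict ((A.domain.comap B.toFun).map B.domain.subtype)) (by
    rintro ⟨ψ, h⟩
    obtain ⟨⟨φ, hφ, rfl⟩, _⟩ := h
    exact hφ)

/-- The commutator `A B - B A` on its natural domain. -/
def pcomm (A B : POp) : POp := pmul A B - pmul B A

/-- The position operator `(X_i ψ)(x) = x_i ψ(x)` on its maximal domain. -/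
def X (i : Fin 2) : POp where
  domain :=
    { carrier := {ψ | Memℓp (fun x : Site => ((x.1 i : ℝ) : ℂ) • ψ x) 2}
      add_mem' := fun {ψ φ} hψ hφ => by
        have h := Memℓp.add hψ hφ
        simp only [Set.mem_ofPred_eq, lp.coeFn_add, Pi.add_apply, smul_add]
        exact h
      zero_mem' := by
        simp only [Set.mem_ofPred_eq, lp.coeFn_zero, Pi.zero_apply, smul_zero]
        exact zero_mem_ℓp'
      smul_mem' := fun c ψ hψ => by
        have h := Memℓp.const_smul hψ c
        simp only [Set.mem_ofPred_eq, lp.coeFn_smul, Pi.smul_apply, smul_comm _ c]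
        exact h }
  toFun :=
    { toFun := fun ψ => ⟨fun x => ((x.1 i : ℝ) : ℂ) • ψ.1 x, ψ.2⟩
      map_add' := fun ψ φ => by ext1; funext x; simp; rfl
      map_smul' := fun c ψ => by ext1; funext x; simp [smul_comm _ c] }

/-- `K` is the bounded operator on the whole space given by the densely defined operator `A`. -/
structure IsBoundedExtension (A : POp) (K : Op) : Prop where
  dense : Dense (A.domain : Set Hil)
  le : A ≤ bdd K

/-! ### Trace per unit volume -/

/-- The fundamental cell of side `L`. -/
def cell (L : ℕ) : Set Site :=
  {x | ∃ α₁ α₂ : ℝ, x.1 = α₁ • a₁ + α₂ • a₂ ∧ |α₁| ≤ (L : ℝ) / 2 ∧ |α₂| ≤ (L : ℝ) / 2}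

lemma bravais_eq {γ : Plane} (hγ : γ ∈ bravais) : ∃ m n : ℤ, γ = m • a₁ + n • a₂ := by
  have h3 : a₃ = (-1 : ℤ) • a₁ + (-1 : ℤ) • a₂ := by
    simp only [a₁, a₂, a₃, neg_smul, one_smul]; abel
  refine Submodule.span_induction (p := fun γ _ => ∃ m n : ℤ, γ = m • a₁ + n • a₂)
    ?_ ⟨0, 0, by simp⟩ ?_ ?_ hγ
  · rintro y (rfl | rfl | rfl)
    exacts [⟨1, 0, by simp⟩, ⟨0, 1, by simp⟩, ⟨-1, -1, h3⟩]
  · rintro x y - - ⟨m, n, rfl⟩ ⟨m', n', rfl⟩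
    exact ⟨m + m', n + n', by simp only [add_smul]; abel⟩
  · rintro c x - ⟨m, n, rfl⟩
    exact ⟨c * m, c * n, by simp only [smul_add, mul_smul]⟩

lemma exists_site (x : Site) : ∃ (n : ℤ × ℤ) (c : Fin 2), x = site n c := by
  obtain ⟨x, h | h⟩ := x
  · obtain ⟨m, n, rfl⟩ := bravais_eq h
    exact ⟨(m, n), 0, Subtype.ext (by simp [site])⟩
  · obtain ⟨m, n, h'⟩ := bravais_eq h
    refine ⟨(m, n), 1, Subtype.ext ?_⟩
    simp only [site, one_ne_zero, if_false]
    rw [← h']; abel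

lemma cell_finite (L : ℕ) : (cell L).Finite := by
  refine Set.Finite.subset (((Set.finite_Icc (-(L + 1 : ℤ)) (L + 1)).prod
    (Set.finite_Icc (-(L + 1 : ℤ)) (L + 1))).prod (Set.finite_univ (α := Fin 2)) |>.image
      (fun p => site p.1 p.2)) ?_
  rintro x ⟨α, β, hx, hα, hβ⟩
  obtain ⟨⟨m, n⟩, c, rfl⟩ := exists_site x
  refine ⟨((m, n), c), ?_, rfl⟩
  have h3 : √3 ≠ 0 := by positivity
  have e0 := congrFun hx 0
  have e1 := congrFun hx 1
  have hL : (0 : ℝ) ≤ L := Nat.cast_nonneg L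
  rw [abs_le] at hα hβ
  have key : |(m : ℝ)| ≤ L + 1 ∧ |(n : ℝ)| ≤ L + 1 := by
    fin_cases c
    · simp [site, a₁, a₂, d₁, d₂, d₃] at e0 e1
      have e1' : (m : ℝ) + n = α + β := mul_right_cancel₀ h3 (by linarith)
      constructor <;> rw [abs_le] <;> constructor <;> linarith
    · simp [site, a₁, a₂, d₁, d₂, d₃] at e0 e1
      have e1' : (m : ℝ) + n = α + β := mul_right_cancel₀ h3 (by linarith)
      constructor <;> rw [abs_le] <;> constructor <;> linarith
  obtain ⟨k1, k2⟩ := key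
  rw [abs_le] at k1 k2
  simp only [Set.mem_prod, Set.mem_Icc, Set.mem_univ, and_true]
  refine ⟨⟨?_, ?_⟩, ?_, ?_⟩
  · exact_mod_cast k1.1
  · exact_mod_cast k1.2
  · exact_mod_cast k2.1
  · exact_mod_cast k2.2

/-- `t` is the trace per unit volume of `A`: the operators `χ_L A χ_L` are everywhere defined, and
`Tr(χ_L A χ_L) / |C_L|` tends to `t` as `L → ∞` along the odd integers. The range of `χ_L` is
spanned by the vectors `δ x s` with `x ∈ C_L`, and the trace is computed in the basis `δ`. -/
def HasTracePerVolume (A : POp) (t : ℂ) : Prop :=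
  ∃ h : ∀ x s, δ x s ∈ A.domain,
    Filter.Tendsto
      (fun k : ℕ => (((cell (2 * k + 1)).ncard : ℂ))⁻¹ *
        ∑ x ∈ (cell_finite (2 * k + 1)).toFinset, ∑ s : Fin 2, inner ℂ (δ x s) (A ⟨δ x s, h x s⟩))
      Filter.atTop (𝓝 t)

/-! ### Spin conductivity -/

/-- The conventional spin current `(i/2) [H, X_i] S_z + (i/2) S_z [H, X_i]`. -/
def Jconv (H : Op) (i : Fin 2) : POp :=
  (Complex.I / 2) • pmul (pcomm (bdd H) (X i)) (bdd Sz) +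
    (Complex.I / 2) • pmul (bdd Sz) (pcomm (bdd H) (X i))

/-- The proper spin current `i [H, X_i S_z]`. -/
def Jprop (H : Op) (i : Fin 2) : POp :=
  Complex.I • pcomm (bdd H) (pmul (X i) (bdd Sz))

/-- The number `σ` is the adiabatic linear response coefficient
`lim_{η → 0⁺} Re τ(J L_{η,j})` of the observable `J`, all the objects in this expression
being well defined: `[X_j, P]` extends to a bounded operator, the trace per unit volume of
`J L_{η,j}` exists for every `η > 0`, and the limit exists. -/
def IsResponseCoefficient (H : Op) (μ : ℝ) (J : POp) (j : Fin 2) (σ : ℝ) : Prop :=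
  ∃ K : Op, IsBoundedExtension (pcomm (X j) (bdd (fermi H μ))) K ∧
    ∃ t : ℝ → ℂ,
      (∀ η : ℝ, 0 < η → HasTracePerVolume (pmul J (bdd (linearResponse H K η))) (t η)) ∧
      Filter.Tendsto (fun η => (t η).re) (𝓝[>] 0) (𝓝 σ)

end SpinHall

end

/-! Let a = (H - μ)/c, with c so large that the spectrum of a lies in [-1, 1]; by the gap it stays
away from 0. Then S = sgn a = 1 - 2P equals a · Σ bₙ (1 - a²)ⁿ, with bₙ the coefficients of (1 -
x)^(-1/2), and |a| = 1 - F with ‖F‖ < 1 (`IsInsulator.exists_sign_series`).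

For η > 0 the response L is the only bounded solution of [H, L] - iηL = K, where K = [X_j, P]
(`linearResponse_eq`). Since P² = P, K is off-diagonal with respect to P. On off-diagonal blocks the
commutator with a is, up to sign, the anticommutator with |a|, so the equation becomes (2 ∓ iη/c) L
- F L - L F = Y. This is a fixed point problem, contracting uniformly in η ≥ 0: the gap makes it
solvable at η = 0 too, L converges in norm as η → 0⁺, and the limit is self-adjoint
(`exists_liouville`).

Positions are unbounded, so P, K and L must be periodic and short-range. Short range amounts to
boundedness of e^{θ·n} A e^{-θ·n} for small θ. The pairs formed by A and its conjugate are a closed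
subalgebra (`conjGraph`), so the sign series and the contraction argument can be run on pairs
(`isLocal_of_series`, `isLocal_sylvester`).

For periodic operators the trace per unit volume is half the trace over one cell. The proper current
also contains the non-periodic term X_i [H, S_z] L. Its spin trace at a site is the position times
the site trace of [H, S_z] L_j, which is a rotation invariant vector in j and hence zero. What then
separates the two currents is, at η = 0, i times the trace of a product of two self-adjoint
operators. That trace is real by cyclicity, so the real parts agree.

Finally, the tensor of site traces is rotation covariant, and the reflection, which anticommutes
with S_z, changes its sign. The reflection kills the diagonal, and the rotation then forces
antisymmetry (`antisymm_of_covariant`). -/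

noncomputable section

namespace SpinHall

/-! ### Sylvester equations: existence, a priori bound, uniqueness. -/

section Sylvester

variable {R : Type*} [NormedRing R] [NormedAlgebra ℂ R]

/-- The Sylvester equation `z L - F L - L F = Y` with `2 ‖F‖ < |z|` is solvable inside every
closed subspace that contains `Y` and is stable under multiplication by `F`. -/
lemma exists_sylvester [CompleteSpace R] (F Y : R) (z : ℂ) (h : 2 * ‖F‖ < ‖z‖)
    (V : Submodule ℂ R) (hV : IsClosed (V : Set R)) (hF : ∀ x ∈ V, F * x ∈ V ∧ x * F ∈ V)
    (hY : Y ∈ V) : ∃ L ∈ V, z • L - F * L - L * F = Y := by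
  have hz : 0 < ‖z‖ := lt_of_le_of_lt (by positivity) h
  have hz0 : z ≠ 0 := norm_pos_iff.1 hz
  have : CompleteSpace V := hV.completeSpace_coe
  -- The fixed points of this map are the solutions, and its Lipschitz constant is 2‖F‖/‖z‖ < 1.
  let f : V → V := fun x => ⟨z⁻¹ • (Y + (F * x + x * F)),
    V.smul_mem _ (V.add_mem hY (V.add_mem (hF x x.2).1 (hF x x.2).2))⟩
  have hf : ContractingWith (2 * ‖F‖ / ‖z‖).toNNReal f := by
    refine ⟨?_, LipschitzWith.of_dist_le_mul fun x y => ?_⟩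
    · rw [Real.toNNReal_lt_one, div_lt_one hz]
      exact h
    · rw [Real.coe_toNNReal _ (by positivity), Subtype.dist_eq, Subtype.dist_eq, dist_eq_norm, dist_eq_norm]
      have e : (f x : R) - f y = z⁻¹ • (F * ((x : R) - y) + ((x : R) - y) * F) := by
        simp only [f, ← smul_sub]
        congr 1
        noncomm_ring
      rw [e, norm_smul, norm_inv]
      have h1 : ‖F * ((x : R) - y) + ((x : R) - y) * F‖ ≤ 2 * ‖F‖ * ‖(x : R) - y‖ := by
        refine (norm_add_le _ _).trans ?_
        have := norm_mul_le F ((x : R) - y)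
        have := norm_mul_le ((x : R) - y) F
        linarith
      calc ‖z‖⁻¹ * _ ≤ ‖z‖⁻¹ * (2 * ‖F‖ * ‖(x : R) - y‖) := by gcongr
        _ = 2 * ‖F‖ / ‖z‖ * ‖(x : R) - y‖ := by ring
  obtain ⟨x, hx, -⟩ := hf.exists_fixedPoint 0 (edist_ne_top _ _)
  refine ⟨x, x.2, ?_⟩
  have hx' : z⁻¹ • (Y + (F * x + x * F)) = (x : R) := congrArg Subtype.val hx
  have : z • (x : R) = Y + (F * x + x * F) := by
    rw [← hx', smul_inv_smul₀ hz0, hx']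
  rw [this]
  abel

/-- Coercivity from the triangle inequality. It yields both uniqueness and the norm continuity of
the solution in z. -/
lemma norm_sylvester_le {F L Y : R} {z : ℂ} (h : z • L - F * L - L * F = Y) :
    (‖z‖ - 2 * ‖F‖) * ‖L‖ ≤ ‖Y‖ := by
  have h1 : z • L = Y + (F * L + L * F) := by rw [← h]; abel
  have h2 : ‖z‖ * ‖L‖ ≤ ‖Y‖ + 2 * ‖F‖ * ‖L‖ := by
    rw [← norm_smul, h1]
    refine (norm_add_le _ _).trans ?_
    have := norm_add_le (F * L) (L * F)
    have := norm_mul_le F L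
    have := norm_mul_le L F
    linarith
  linarith

lemma sylvester_unique {F L L' Y : R} {z : ℂ} (hz : 2 * ‖F‖ < ‖z‖)
    (h : z • L - F * L - L * F = Y) (h' : z • L' - F * L' - L' * F = Y) : L = L' := by
  have h0 : z • (L - L') - F * (L - L') - (L - L') * F = 0 := by
    rw [← sub_eq_zero.2 (h.trans h'.symm), smul_sub]
    noncomm_ring
  have h1 := norm_sylvester_le h0
  rw [norm_zero] at h1
  have h2 : ‖L - L'‖ = 0 := by
    by_contra hne
    have : 0 < ‖L - L'‖ := lt_of_le_of_ne (norm_nonneg _) (Ne.symm hne)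
    have := mul_pos (sub_pos.2 hz) this
    linarith
  exact sub_eq_zero.1 (norm_eq_zero.1 h2)

end Sylvester

/-! ### The linear response as a solution of the Liouville equation. -/

lemma exp_I_mul_mem_unitary {A : Type*} [CStarAlgebra A] {a : A} (ha : IsSelfAdjoint a) (s : ℝ) :
    NormedSpace.exp ((Complex.I * (s : ℂ)) • a) ∈ unitary A ∧
    NormedSpace.exp (-(Complex.I * (s : ℂ)) • a) ∈ unitary A := by
  have key : ∀ t : ℝ, NormedSpace.exp ((Complex.I * (t : ℂ)) • a) ∈ unitary A := by
    intro t
    have h : IsSelfAdjoint (t • a) := (IsSelfAdjoint.all t).smul ha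
    have h' := (selfAdjoint.expUnitary ⟨t • a, h⟩).2
    rw [selfAdjoint.expUnitary_coe] at h'
    rwa [mul_smul, Complex.coe_smul]
  refine ⟨key s, ?_⟩
  have := key (-s)
  simpa using this

section Hilbert

variable {E : Type*} [NormedAddCommGroup E] [InnerProductSpace ℂ E] [CompleteSpace E]

lemma hasDerivAt_exp_I_mul (H : E →L[ℂ] E) (s : ℝ) :
    HasDerivAt (fun s : ℝ => NormedSpace.exp ((Complex.I * (s : ℂ)) • H))
      (NormedSpace.exp ((Complex.I * (s : ℂ)) • H) * (Complex.I • H)) s := by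
  have h := hasDerivAt_exp_smul_const (Complex.I • H) s (𝕂 := ℝ)
  have e : ∀ t : ℝ, t • (Complex.I • H) = (Complex.I * (t : ℂ)) • H := by
    intro t
    rw [mul_comm, mul_smul, Complex.coe_smul]
  simpa only [e] using h

lemma hasDerivAt_exp_neg_I_mul (H : E →L[ℂ] E) (s : ℝ) :
    HasDerivAt (fun s : ℝ => NormedSpace.exp (-(Complex.I * (s : ℂ)) • H))
      (-(Complex.I • H) * NormedSpace.exp (-(Complex.I * (s : ℂ)) • H)) s := by
  have h := hasDerivAt_exp_smul_const' (-(Complex.I • H)) s (𝕂 := ℝ)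
  have e : ∀ t : ℝ, t • -(Complex.I • H) = (-(Complex.I * (t : ℂ))) • H := by
    intro t
    rw [smul_neg, neg_smul, mul_comm, mul_smul, Complex.coe_smul]
  simpa only [e] using h

/-- The linear response is the unique bounded solution of the Liouville equation. -/
lemma linearResponse_eq {H K L : E →L[ℂ] E} (hH : IsSelfAdjoint H) {η : ℝ} (hη : 0 < η)
    (hL : H * L - L * H - (Complex.I * (η : ℂ)) • L = K) : linearResponse H K η = L := by
  set U : ℝ → E →L[ℂ] E := fun s => NormedSpace.exp ((Complex.I * (s : ℂ)) • H) with hU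
  set W : ℝ → E →L[ℂ] E := fun s => NormedSpace.exp (-(Complex.I * (s : ℂ)) • H) with hW
  have hbound : ∀ (B : E →L[ℂ] E) (s : ℝ), ‖U s * B * W s‖ ≤ ‖B‖ := by
    intro B s
    rw [CStarRing.norm_mul_mem_unitary _ (exp_I_mul_mem_unitary hH s).2,
      CStarRing.norm_mem_unitary_mul _ (exp_I_mul_mem_unitary hH s).1]
  have hexp : ∀ s : ℝ, HasDerivAt (fun s : ℝ => Real.exp (η * s)) (η * Real.exp (η * s)) s := by
    intro s
    simpa [mul_comm] using ((hasDerivAt_id s).const_mul η).exp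
  -- By the Liouville equation the integrand is an exact derivative. Its primitive equals L at s = 0
  -- and vanishes at -∞, because U and W are unitary and η > 0.
  have hderiv : ∀ s : ℝ, HasDerivAt (fun s => Real.exp (η * s) • (U s * L * W s))
      (Complex.I • (Real.exp (η * s) • (U s * K * W s))) s := by
    intro s
    have h := (hexp s).smul
      (((hasDerivAt_exp_I_mul H s).mul_const L).mul (hasDerivAt_exp_neg_I_mul H s))
    refine h.congr_deriv ?_
    rw [← hL]
    simp only [hU, hW, Pi.mul_apply, mul_sub, sub_mul, mul_smul_comm, smul_mul_assoc, smul_sub,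
      mul_assoc, neg_mul, mul_neg, smul_add, smul_neg]
    simp only [← Complex.coe_smul, smul_smul]
    have e1 : Complex.I * (((Real.exp (η * s) : ℝ) : ℂ) * (Complex.I * (η : ℂ))) =
        -(((η * Real.exp (η * s) : ℝ) : ℂ)) := by
      push_cast
      linear_combination (Complex.exp (η * s) * η) * Complex.I_mul_I
    rw [e1, mul_comm _ Complex.I]
    module
  have hcont : Continuous (fun s => U s * K * W s) := by
    refine Continuous.mul (Continuous.mul ?_ continuous_const) ?_
    · exact continuous_iff_continuousAt.2 fun s => (hasDerivAt_exp_I_mul H s).continuousAt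
    · exact continuous_iff_continuousAt.2 fun s => (hasDerivAt_exp_neg_I_mul H s).continuousAt
  have hint : MeasureTheory.IntegrableOn (fun s : ℝ => Real.exp (η * s) • (U s * K * W s))
      (Set.Iic 0) := by
    have h0 : MeasureTheory.IntegrableOn (fun s : ℝ => Real.exp (η * s) * ‖K‖) (Set.Iic 0) :=
      (integrableOn_exp_mul_Iic hη 0).mul_const _
    refine MeasureTheory.Integrable.mono' h0 ?_ (Filter.Eventually.of_forall fun s => ?_)
    · exact (Continuous.smul (f := fun s : ℝ => Real.exp (η * s)) (by fun_prop) hcont).aestronglyMeasurable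
    · rw [norm_smul, Real.norm_of_nonneg (Real.exp_pos _).le]
      exact mul_le_mul_of_nonneg_left (hbound K s) (Real.exp_pos _).le
  have htend : Filter.Tendsto (fun s => Real.exp (η * s) • (U s * L * W s)) Filter.atBot (𝓝 0) := by
    refine squeeze_zero_norm (a := fun s => Real.exp (η * s) * ‖L‖) (fun s => ?_) ?_
    · rw [norm_smul, Real.norm_of_nonneg (Real.exp_pos _).le]
      exact mul_le_mul_of_nonneg_left (hbound L s) (Real.exp_pos _).le
    · have : Filter.Tendsto (fun s : ℝ => Real.exp (η * s)) Filter.atBot (𝓝 0) :=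
        Real.tendsto_exp_atBot.comp (Filter.tendsto_id.const_mul_atBot hη)
      simpa using this.mul_const ‖L‖
  have hI := MeasureTheory.integral_Iic_of_hasDerivAt_of_tendsto' (a := (0 : ℝ))
    (fun s _ => hderiv s) (hint.smul Complex.I) htend
  have hfin : linearResponse H K η = ∫ s in Set.Iic (0 : ℝ),
      Complex.I • (Real.exp (η * s) • (U s * K * W s)) := by
    rw [MeasureTheory.integral_smul]
    rfl
  rw [hfin, hI]
  simp [hU, hW, NormedSpace.exp_zero]

end Hilbert

/-! ### The sign of H - μ as a power series. -/

/-- The binomial series of `(1 - x)^(-1/2)`. -/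
lemma exists_hasSum_inv_sqrt : ∃ b : ℕ → ℝ,
    (∀ r : ℝ, 0 ≤ r → r < 1 → Summable fun n => |b n| * r ^ n) ∧
    ∀ x : ℝ, 0 ≤ x → x < 1 → HasSum (fun n => b n * x ^ n) (√(1 - x))⁻¹ := by
  have h := Real.one_div_one_sub_rpow_hasFPowerSeriesOnBall_zero (1 / 2)
  refine ⟨fun n => Ring.choose ((1 / 2 : ℝ) + n - 1) n, fun r hr0 hr => ?_, fun x hx0 hx => ?_⟩
  · have h1 : (r.toNNReal : ENNReal) < 1 := by
      rw [← ENNReal.coe_one, ENNReal.coe_lt_coe, Real.toNNReal_lt_one]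
      exact hr
    have := FormalMultilinearSeries.summable_norm_mul_pow _ (h1.trans_le h.r_le)
    simpa [FormalMultilinearSeries.ofScalars_norm, Real.coe_toNNReal _ hr0] using this
  · have hx1 : x ∈ Metric.eball (0 : ℝ) 1 := by
      simp only [Metric.mem_eball, edist_zero_right]
      rw [Real.enorm_eq_ofReal hx0, ENNReal.ofReal_lt_one]
      exact hx
    have := h.hasSum hx1
    simpa only [FormalMultilinearSeries.ofScalars_apply_eq, zero_add, ← Real.sqrt_eq_rpow,
      one_div (√(1 - x)), smul_eq_mul] using this

section Hilbert

variable {E : Type*} [NormedAddCommGroup E] [InnerProductSpace ℂ E] [CompleteSpace E]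

/-- The sign of `H - μ`, in terms of the Fermi projection. -/
def fermiSign (H : E →L[ℂ] E) (μ : ℝ) : E →L[ℂ] E := 1 - (2 : ℂ) • fermi H μ

lemma continuousOn_of_notMem {s : Set ℝ} {μ : ℝ} (h : μ ∉ s) (α β : ℝ) :
    ContinuousOn (fun t : ℝ => if t ≤ μ then α else β) s := by
  intro t ht
  refine ContinuousAt.continuousWithinAt ?_
  rcases lt_trichotomy t μ with hlt | rfl | hgt
  · refine (continuousAt_const (y := α)).congr ?_
    filter_upwards [eventually_lt_nhds hlt] with u hu
    rw [if_pos hu.le]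
  · exact absurd ht h
  · refine (continuousAt_const (y := β)).congr ?_
    filter_upwards [eventually_gt_nhds hgt] with u hu
    rw [if_neg (not_le.2 hu)]

lemma IsInsulator.notMem {H : E →L[ℂ] E} {μ : ℝ} (h : IsInsulator H μ) : μ ∉ spectrum ℝ H := by
  intro hμ
  exact h.gap ((spectrum.algebraMap_mem_iff ℂ).2 hμ)

lemma IsInsulator.fermiSign_eq {H : E →L[ℂ] E} {μ : ℝ} (h : IsInsulator H μ) :
    fermiSign H μ = cfc (fun t : ℝ => if t ≤ μ then (-1 : ℝ) else 1) H := by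
  have hc := continuousOn_of_notMem h.notMem 1 0
  have e : (fun t : ℝ => if t ≤ μ then (-1 : ℝ) else 1) =
      fun t => 1 - 2 * (if t ≤ μ then (1 : ℝ) else 0) := by
    funext t; split_ifs <;> norm_num
  rw [fermiSign, fermi, e, cfc_sub (fun _ => (1 : ℝ)) _ H (by fun_prop) (by fun_prop),
    cfc_const_one ℝ H h.selfAdjoint, cfc_const_mul _ _ H hc, two_smul, two_smul]

lemma IsInsulator.isSelfAdjoint_fermi {H : E →L[ℂ] E} {μ : ℝ} : IsSelfAdjoint (fermi H μ) :=
  cfc_predicate _ _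

lemma IsInsulator.fermi_mul_fermi {H : E →L[ℂ] E} {μ : ℝ} (h : IsInsulator H μ) :
    fermi H μ * fermi H μ = fermi H μ := by
  have hc := continuousOn_of_notMem h.notMem 1 0
  rw [fermi, ← cfc_mul _ _ H hc hc]
  congr 1
  funext t
  split_ifs <;> norm_num

lemma commute_fermi {H U : E →L[ℂ] E} {μ : ℝ} (hU : Commute H U) :
    Commute (fermi H μ) U :=
  hU.cfc_real _

/-- The rescaled Hamiltonian `(H - μ) / c`. -/
def rescaled (H : E →L[ℂ] E) (μ c : ℝ) : E →L[ℂ] E := ((c⁻¹ : ℝ) : ℂ) • (H - (μ : ℂ) • 1)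

-- The partial sums of the sign series are polynomials in H, so their convergence can be checked
-- uniformly on the spectrum.
open Polynomial in
lemma cfc_rescaled {H : E →L[ℂ] E} (hH : IsSelfAdjoint H) (μ c : ℝ) (b : ℕ → ℝ) (N : ℕ) :
    cfc (fun t : ℝ => (c⁻¹ * (t - μ)) *
      ∑ n ∈ Finset.range N, b n * (1 - (c⁻¹ * (t - μ)) * (c⁻¹ * (t - μ))) ^ n) H =
      rescaled H μ c * ∑ n ∈ Finset.range N, (b n : ℂ) •
        (1 - rescaled H μ c * rescaled H μ c) ^ n := by
  have h0 : aeval H (C c⁻¹ * (Polynomial.X - C μ) : ℝ[X]) = rescaled H μ c := by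
    rw [rescaled, Complex.coe_smul, Complex.coe_smul]
    simp [Algebra.algebraMap_eq_smul_one]
  have h := cfc_polynomial ((C c⁻¹ * (Polynomial.X - C μ)) *
      ∑ n ∈ Finset.range N, C (b n) * (1 - (C c⁻¹ * (Polynomial.X - C μ)) * (C c⁻¹ * (Polynomial.X - C μ))) ^ n) H hH
  rw [map_mul, map_sum, h0] at h
  simp only [map_mul, map_pow, map_sub, map_one, h0] at h
  simpa [eval_finsetSum, Algebra.algebraMap_eq_smul_one] using h

lemma IsInsulator.exists_gap {H : E →L[ℂ] E} {μ : ℝ} (h : IsInsulator H μ) :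
    ∃ c r : ℝ, 0 < c ∧ 0 ≤ r ∧ r < 1 ∧ ∀ t ∈ spectrum ℝ H,
      |c⁻¹ * (t - μ)| ≤ 1 ∧ 1 - r ≤ |c⁻¹ * (t - μ)| * |c⁻¹ * (t - μ)| := by
  have hcl : IsClosed (spectrum ℝ H) := spectrum.isClosed H
  obtain ⟨g, hg, hball⟩ := Metric.isOpen_iff.1 hcl.isOpen_compl μ h.notMem
  have hc : 0 < ‖H‖ * ‖(1 : E →L[ℂ] E)‖ + |μ| + g := by positivity
  -- The first two terms bound |t - μ| on the spectrum; adding the gap width g makes c positive and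
  -- gives g/c ≤ 1.
  set c := ‖H‖ * ‖(1 : E →L[ℂ] E)‖ + |μ| + g with hcdef
  have hgc : g ≤ c := by
    have : 0 ≤ ‖H‖ * ‖(1 : E →L[ℂ] E)‖ + |μ| := by positivity
    linarith
  refine ⟨c, 1 - g / c * (g / c), hc, ?_, ?_, fun t ht => ?_⟩
  · have h1 : g / c ≤ 1 := (div_le_one hc).2 hgc
    have := mul_le_one₀ h1 (div_pos hg hc).le h1
    linarith
  · have := mul_pos (div_pos hg hc) (div_pos hg hc)
    linarith
  · have h1 : |t| ≤ ‖H‖ * ‖(1 : E →L[ℂ] E)‖ := spectrum.norm_le_norm_mul_of_mem ht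
    have h2 : g ≤ |t - μ| := by
      by_contra hlt
      exact hball (by simpa [Real.dist_eq] using hlt) ht
    have h3 : |t - μ| ≤ c := by
      have := abs_sub t μ
      linarith
    rw [abs_mul, abs_of_pos (inv_pos.2 hc), sub_sub_cancel]
    constructor
    · rw [inv_mul_le_one₀ hc]; exact h3
    · rw [div_eq_inv_mul]
      gcongr

/-- With a the rescaled Hamiltonian, sgn a = a (a²)^(-1/2) is expanded in powers of 1 - a², which
the gap makes a strict contraction. The operator 1 - a sgn a = 1 - |a| is a strict contraction for
the same reason; it drives the Sylvester equations. -/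
lemma IsInsulator.exists_sign_series {H : E →L[ℂ] E} {μ : ℝ} (h : IsInsulator H μ) :
    ∃ c r : ℝ, ∃ b : ℕ → ℝ, 0 < c ∧ 0 ≤ r ∧ r < 1 ∧
      (∀ r : ℝ, 0 ≤ r → r < 1 → Summable fun n => |b n| * r ^ n) ∧
      ‖1 - rescaled H μ c * rescaled H μ c‖ ≤ r ∧
      ‖1 - rescaled H μ c * fermiSign H μ‖ ≤ r ∧
      Filter.Tendsto (fun N => rescaled H μ c * ∑ n ∈ Finset.range N, (b n : ℂ) •
        (1 - rescaled H μ c * rescaled H μ c) ^ n) Filter.atTop (𝓝 (fermiSign H μ)) := by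
  obtain ⟨c, r, hc, hr0, hr1, hspec⟩ := h.exists_gap
  obtain ⟨b, hb, hsum⟩ := exists_hasSum_inv_sqrt
  have hH := h.selfAdjoint
  have ha : rescaled H μ c = cfc (fun t : ℝ => c⁻¹ * (t - μ)) H := by
    have := cfc_rescaled hH μ c (fun _ => 1) 1
    simpa using this.symm
  have hbd : ∀ t ∈ spectrum ℝ H, |1 - (c⁻¹ * (t - μ)) * (c⁻¹ * (t - μ))| ≤ r ∧
      0 ≤ 1 - (c⁻¹ * (t - μ)) * (c⁻¹ * (t - μ)) := by
    intro t ht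
    obtain ⟨h1, h2⟩ := hspec t ht
    set u := c⁻¹ * (t - μ)
    have h3 : u * u = |u| * |u| := (abs_mul_abs_self u).symm
    have h4 : 0 ≤ 1 - u * u := by rw [h3]; nlinarith [abs_nonneg u]
    refine ⟨?_, h4⟩
    rw [abs_of_nonneg h4, h3]
    linarith
  have hsgn : ∀ t ∈ spectrum ℝ H, (c⁻¹ * (t - μ)) * (if t ≤ μ then (-1 : ℝ) else 1) =
      |c⁻¹ * (t - μ)| := by
    intro t _
    have hci := inv_pos.2 hc
    split_ifs with hle
    · rw [abs_of_nonpos (mul_nonpos_of_nonneg_of_nonpos hci.le (by linarith))]; ring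
    · rw [abs_of_nonneg (mul_nonneg hci.le (by linarith [not_le.1 hle]))]; ring
  have hcs := continuousOn_of_notMem h.notMem (-1) 1
  refine ⟨c, r, b, hc, hr0, hr1, hb, ?_, ?_, ?_⟩
  · have e : 1 - rescaled H μ c * rescaled H μ c =
        cfc (fun t : ℝ => 1 - (c⁻¹ * (t - μ)) * (c⁻¹ * (t - μ))) H := by
      rw [ha, ← cfc_mul _ _ H (by fun_prop) (by fun_prop), ← cfc_const_one ℝ H hH,
        ← cfc_sub _ _ H (by fun_prop) (by fun_prop)]
    rw [e]
    exact norm_cfc_le hr0 fun t ht => (hbd t ht).1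
  · have e : 1 - rescaled H μ c * fermiSign H μ =
        cfc (fun t : ℝ => 1 - (c⁻¹ * (t - μ)) * (if t ≤ μ then (-1 : ℝ) else 1)) H := by
      rw [ha, h.fermiSign_eq, ← cfc_mul _ _ H (by fun_prop) hcs, ← cfc_const_one ℝ H hH,

        ← cfc_sub (fun _ => (1 : ℝ))
          (fun t => c⁻¹ * (t - μ) * (if t ≤ μ then (-1 : ℝ) else 1)) H (by fun_prop)
          (ContinuousOn.mul (by fun_prop) hcs)]
    rw [e]
    refine norm_cfc_le hr0 fun t ht => ?_
    obtain ⟨h1, h2⟩ := hspec t ht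
    rw [hsgn t ht, Real.norm_eq_abs, abs_of_nonneg (by linarith)]
    -- With u the absolute value, u ≤ 1 gives 1 - u ≤ 1 - u² ≤ r.
    nlinarith [abs_nonneg (c⁻¹ * (t - μ))]
  · simp_rw [← cfc_rescaled hH μ c b]
    rw [h.fermiSign_eq]
    refine tendsto_cfc_fun ?_ (Filter.Eventually.of_forall fun N => by fun_prop)
    -- Weierstrass M-test on the spectrum, with majorant |bₙ| rⁿ.
    have hu := tendstoUniformlyOn_tsum_nat (hb r hr0 hr1)
      (f := fun n t => (c⁻¹ * (t - μ)) * (b n * (1 - (c⁻¹ * (t - μ)) * (c⁻¹ * (t - μ))) ^ n))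
      (s := spectrum ℝ H) (by
        intro n t ht
        rw [Real.norm_eq_abs, abs_mul, abs_mul (b n), abs_pow]
        have h1 := (hspec t ht).1
        have h2 : |1 - (c⁻¹ * (t - μ)) * (c⁻¹ * (t - μ))| ^ n ≤ r ^ n :=
          pow_le_pow_left₀ (abs_nonneg _) (hbd t ht).1 n
        calc _ ≤ 1 * (|b n| * r ^ n) := by gcongr
          _ = _ := one_mul _)
    refine (hu.congr_right ?_).congr (Filter.Eventually.of_forall fun N t _ => ?_)
    · intro t ht
      set u := c⁻¹ * (t - μ) with hudef
      have hu0 : 0 < |u| := by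
        have h2 := (hspec t ht).2
        have h0 := abs_nonneg u
        refine lt_of_le_of_ne h0 fun h => ?_
        rw [← hudef, ← h] at h2
        linarith
      have h1 := hsum (1 - u * u) (hbd t ht).2
        (lt_of_le_of_lt ((le_abs_self _).trans (hbd t ht).1) hr1)
      rw [sub_sub_cancel, ← sq, Real.sqrt_sq_eq_abs] at h1
      have h2 := (h1.mul_left u).tsum_eq
      simp only [← sq] at h2 ⊢
      rw [h2]
      have h3 := hsgn t ht
      rw [← hudef] at h3
      rw [← h3, mul_inv_rev]
      have hu1 : u ≠ 0 := abs_pos.1 hu0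
      split_ifs <;> field_simp
    · simp only [Finset.mul_sum]

end Hilbert

/-! ### Matrix elements in the canonical basis. -/

/-- Labels of the canonical basis: the cell, the sublattice and the spin. -/
abbrev Label : Type := (ℤ × ℤ) × Fin 2 × Fin 2

lemma site_injective {n m : ℤ × ℤ} {c c' : Fin 2} (h : site n c = site m c') :
    n = m ∧ c = c' := by
  have h3 : √3 ≠ 0 := by positivity
  have e0 := congrFun (congrArg Subtype.val h) 0
  have e1 := congrFun (congrArg Subtype.val h) 1
  obtain ⟨n1, n2⟩ := n
  obtain ⟨m1, m2⟩ := m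
  fin_cases c <;> fin_cases c' <;> simp [site, a₁, a₂, d₁, d₂, d₃] at e0 e1 ⊢
  · have e1' : (n1 : ℝ) + n2 = m1 + m2 := mul_right_cancel₀ h3 (by linarith)
    constructor
    · have : (n1 : ℝ) = m1 := by linarith
      exact_mod_cast this
    · have : (n2 : ℝ) = m2 := by linarith
      exact_mod_cast this
  · have e1' : (n1 : ℝ) + n2 = m1 + m2 := mul_right_cancel₀ h3 (by linarith)
    -- In units of 1/2, the first coordinates of the two sublattices lie in different classes modulo
    -- 3.
    have : 3 * (n1 - n2 : ℤ) = 3 * (m1 - m2) - (2 : ℤ) := by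
      have : 3 * ((n1 : ℝ) - n2) = 3 * (m1 - m2) - 2 := by linarith
      exact_mod_cast this
    omega
  · have e1' : (n1 : ℝ) + n2 = m1 + m2 := mul_right_cancel₀ h3 (by linarith)
    have : 3 * (n1 - n2 : ℤ) - 2 = 3 * (m1 - m2) := by
      have : 3 * ((n1 : ℝ) - n2) - 2 = 3 * (m1 - m2) := by linarith
      exact_mod_cast this
    omega
  · have e1' : (n1 : ℝ) + n2 = m1 + m2 := mul_right_cancel₀ h3 (by linarith)
    constructor
    · have : (n1 : ℝ) = m1 := by linarith
      exact_mod_cast this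
    · have : (n2 : ℝ) = m2 := by linarith
      exact_mod_cast this

open Classical in
lemma inner_δ_left (x : Site) (s : Fin 2) (ψ : Hil) : inner ℂ (δ x s) ψ = ψ x s := by
  rw [δ, lp.inner_single_left]
  simp [EuclideanSpace.inner_single_left]

open Classical in
lemma δ_apply (x y : Site) (s t : Fin 2) : δ x s y t = if x = y ∧ s = t then 1 else 0 := by
  rw [δ, lp.single_apply]
  by_cases h : x = y
  · subst h
    simp [eq_comm]
  · simp [h, Ne.symm h]

/-- The canonical basis vectors. -/
def bvec (i : Label) : Hil := δ (site i.1 i.2.1) i.2.2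

lemma inner_bvec_bvec (i j : Label) : inner ℂ (bvec i) (bvec j) = if i = j then (1 : ℂ) else 0 := by
  classical
  rw [bvec, inner_δ_left, bvec, δ_apply]
  refine if_congr ⟨fun h => ?_, fun h => ?_⟩ rfl rfl
  · obtain ⟨h1, h2⟩ := site_injective h.1
    exact (Prod.ext h1 (Prod.ext h2 h.2)).symm
  · subst h; exact ⟨rfl, rfl⟩

lemma orthonormal_bvec : Orthonormal ℂ bvec := orthonormal_iff_ite.2 inner_bvec_bvec

lemma eq_of_inner_bvec {ψ φ : Hil} (h : ∀ i, inner ℂ (bvec i) ψ = inner ℂ (bvec i) φ) : ψ = φ := by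
  ext x s
  obtain ⟨n, c, rfl⟩ := exists_site x
  have := h (n, c, s)
  simpa only [bvec, inner_δ_left] using this

/-- The canonical basis. -/
def basis : HilbertBasis Label ℂ Hil :=
  HilbertBasis.mkOfOrthogonalEqBot orthonormal_bvec (by
    rw [Submodule.eq_bot_iff]
    intro ψ hψ
    refine eq_of_inner_bvec fun i => ?_
    rw [inner_zero_right]
    exact (Submodule.mem_orthogonal _ _).1 hψ _ (Submodule.subset_span ⟨i, rfl⟩))

lemma basis_apply (i : Label) : basis i = bvec i := by
  rw [basis, HilbertBasis.coe_mkOfOrthogonalEqBot]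

/-- The matrix elements of an operator. -/
def ent (A : Op) (i j : Label) : ℂ := inner ℂ (bvec i) (A (bvec j))

lemma clm_ext {A B : Op} (h : ∀ j, A (bvec j) = B (bvec j)) : A = B := by
  refine ContinuousLinearMap.ext_on (s := Set.range basis) ?_ ?_
  · exact (Submodule.dense_iff_topologicalClosure_eq_top.2 basis.dense_span)
  · rintro _ ⟨i, rfl⟩
    rw [basis_apply]
    exact h i

lemma ent_ext {A B : Op} (h : ∀ i j, ent A i j = ent B i j) : A = B :=
  clm_ext fun j => eq_of_inner_bvec fun i => h i j

lemma hasSum_ent_mul (A : Op) (i : Label) (ψ : Hil) :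
    HasSum (fun j => ent A i j * inner ℂ (bvec j) ψ) (inner ℂ (bvec i) (A ψ)) := by
  have h := basis.hasSum_inner_mul_inner (ContinuousLinearMap.adjoint A (bvec i)) ψ
  simpa only [basis_apply, ContinuousLinearMap.adjoint_inner_left] using! h

lemma hasSum_ent (A B : Op) (i k : Label) :
    HasSum (fun j => ent A i j * ent B j k) (ent (A * B) i k) :=
  hasSum_ent_mul A i (B (bvec k))

lemma norm_ent_le (A : Op) (i j : Label) : ‖ent A i j‖ ≤ ‖A‖ := by
  refine (norm_inner_le_norm _ _).trans ?_
  have h := A.le_opNorm (bvec j)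
  rw [orthonormal_bvec.1 i, one_mul]
  rwa [orthonormal_bvec.1 j, mul_one] at h

/-- A matrix element as a bounded linear functional. -/
def entCLM (i j : Label) : Op →L[ℂ] ℂ :=
  (innerSL ℂ (bvec i)).comp (ContinuousLinearMap.apply ℂ Hil (bvec j))

lemma entCLM_apply (i j : Label) (A : Op) : entCLM i j A = ent A i j := rfl

lemma ent_add (A B : Op) (i j) : ent (A + B) i j = ent A i j + ent B i j :=
  map_add (entCLM i j) A B
lemma ent_sub (A B : Op) (i j) : ent (A - B) i j = ent A i j - ent B i j :=
  map_sub (entCLM i j) A B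
lemma ent_smul (c : ℂ) (A : Op) (i j) : ent (c • A) i j = c * ent A i j :=
  map_smul (entCLM i j) c A
lemma ent_neg (A : Op) (i j) : ent (-A) i j = -ent A i j :=
  map_neg (entCLM i j) A
lemma ent_zero (i j) : ent 0 i j = 0 := map_zero (entCLM i j)
lemma ent_sum {ι : Type*} (s : Finset ι) (f : ι → Op) (i j) :
    ent (∑ k ∈ s, f k) i j = ∑ k ∈ s, ent (f k) i j := map_sum (entCLM i j) f s
lemma ent_one (i j) : ent 1 i j = if i = j then 1 else 0 := inner_bvec_bvec i j

lemma ent_star (A : Op) (i j : Label) : ent (star A) i j = star (ent A j i) := by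
  rw [ent, ContinuousLinearMap.star_eq_adjoint, ContinuousLinearMap.adjoint_inner_right, ent]
  exact (inner_conj_symm _ _).symm

/-! ### Twists in the canonical basis -/

lemma twist_δ_apply (M : Matrix (Fin 2) (Fin 2) ℂ) (e : Equiv.Perm Site) (x y : Site)
    (s t : Fin 2) : twist M e (δ x s) y t = if e x = y then M t s else 0 := by
  classical
  rw [twist_apply]
  by_cases h : e x = y
  · rw [if_pos h, ← h, Equiv.symm_apply_apply]
    have : δ x s x = EuclideanSpace.single s (1 : ℂ) := by
      rw [δ, lp.single_apply_self]
    rw [this]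
    simp
  · rw [if_neg h]
    have : δ x s (e.symm y) = 0 := by
      rw [δ, lp.single_apply_ne]
      intro h'
      exact h (by rw [← h', Equiv.apply_symm_apply])
    rw [this, map_zero]
    rfl

lemma twist_bvec {M : Matrix (Fin 2) (Fin 2) ℂ} {e : Equiv.Perm Site} {s t : Fin 2}
    {u : ℂ} (hM : ∀ t', M t' s = if t' = t then u else 0) {n m : ℤ × ℤ} {c c' : Fin 2}
    (he : e (site n c) = site m c') : twist M e (bvec (n, c, s)) = u • bvec (m, c', t) := by
  classical
  ext y t'
  simp only [bvec, twist_δ_apply, he, lp.coeFn_smul, Pi.smul_apply, PiLp.smul_apply, δ_apply, hM]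
  by_cases h1 : site m c' = y <;> by_cases h2 : t' = t <;> simp [h1, h2, eq_comm]
  intro h; exact absurd h.symm h2

/-- The lattice vector `n₁ a₁ + n₂ a₂`. -/
def latVec (n : ℤ × ℤ) : bravais :=
  ⟨n.1 • a₁ + n.2 • a₂, add_mem (bravais.smul_mem _ a₁_mem) (bravais.smul_mem _ a₂_mem)⟩

lemma exists_latVec (γ : bravais) : ∃ n, γ = latVec n := by
  obtain ⟨m, n, h⟩ := bravais_eq γ.2
  exact ⟨(m, n), Subtype.ext h⟩

lemma shift_site (k n : ℤ × ℤ) (c : Fin 2) : shift (latVec k) (site n c) = site (n + k) c := by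
  apply Subtype.ext
  simp only [shift, latVec, site, Equiv.coe_fn_mk, Prod.fst_add, Prod.snd_add, add_smul]
  abel

lemma T_bvec (k : ℤ × ℤ) (i : Label) : T (latVec k) (bvec i) = bvec (i.1 + k, i.2) := by
  obtain ⟨n, c, s⟩ := i
  have := twist_bvec (M := 1) (s := s) (t := s) (u := 1) (fun t' => by
    rw [Matrix.one_apply]) (shift_site k n c)
  rw [one_smul] at this
  exact this

lemma inner_T_T (k : ℤ × ℤ) (i : Label) (ψ : Hil) :
    inner ℂ (bvec (i.1 + k, i.2)) (T (latVec k) ψ) = inner ℂ (bvec i) ψ := by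
  rw [bvec, inner_δ_left, bvec, inner_δ_left]
  simp only [T, twist_apply, map_one]
  rw [← shift_site, Equiv.symm_apply_apply]
  rfl

lemma isPeriodic_iff {A : Op} :
    IsPeriodic A ↔ ∀ (k : ℤ × ℤ) (i j : Label), ent A (i.1 + k, i.2) (j.1 + k, j.2) = ent A i j := by
  constructor
  · intro h k i j
    have h1 : A (bvec (j.1 + k, j.2)) = T (latVec k) (A (bvec j)) := by
      rw [← T_bvec]
      exact congrArg (fun B : Op => B (bvec j)) (h (latVec k)).eq
    rw [ent, h1, inner_T_T, ent]
  · intro h γ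
    obtain ⟨k, rfl⟩ := exists_latVec γ
    refine clm_ext fun j => eq_of_inner_bvec fun i => ?_
    obtain ⟨i, rfl⟩ : ∃ i' : Label, i = (i'.1 + k, i'.2) := ⟨(i.1 - k, i.2), by simp⟩
    simp only [mul_apply_eq_comp, T_bvec]
    rw [inner_T_T]
    exact h k i j

/-! ### Periodic operators built from summable coefficients. -/

lemma exists_isometry {v : Label → Hil} (hv : Orthonormal ℂ v) :
    ∃ U : Op, ‖U‖ ≤ 1 ∧ ∀ j, U (bvec j) = v j := by
  classical
  let f : Hil →ₗᵢ[ℂ] Hil := hv.orthogonalFamily.linearIsometry.comp basis.repr.toLinearIsometry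
  refine ⟨f.toContinuousLinearMap, f.norm_toContinuousLinearMap_le, fun j => ?_⟩
  have : f (bvec j) = hv.orthogonalFamily.linearIsometry (basis.repr (bvec j)) := rfl
  change f (bvec j) = _
  rw [this, ← basis_apply, basis.repr_self, OrthogonalFamily.linearIsometry_apply_single]
  simp

lemma orthonormal_smul_bvec {χ : Label → ℂ} (hχ : ∀ j, ‖χ j‖ = 1) {e : Label → Label}
    (he : Function.Injective e) : Orthonormal ℂ (fun j => χ j • bvec (e j)) := by
  rw [orthonormal_iff_ite]
  intro i j
  rw [inner_smul_left, inner_smul_right, inner_bvec_bvec]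
  by_cases h : i = j
  · subst h
    simp [Complex.conj_mul', hχ]
  · simp [h, he.ne h]

/-- Matrix elements that depend on the difference of the cells only, indexed by this difference
and the internal degrees of freedom. -/
abbrev Coeff : Type := (ℤ × ℤ) × (Fin 2 × Fin 2) × (Fin 2 × Fin 2)

/-- Half the sum of two isometries that move basis vectors alike but differ in sign wherever the
internal index is not q. These columns cancel, and the norm bound costs nothing. -/
lemma exists_elementary (d : Coeff) : ∃ U : Op, ‖U‖ ≤ 1 ∧
    ∀ i j, ent U i j = if (i.1 - j.1, i.2, j.2) = d then 1 else 0 := by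
  obtain ⟨d, p, q⟩ := d
  let e : Label → Label := fun j => (j.1 + d, Equiv.swap q p j.2)
  have he : Function.Injective e := by
    rintro ⟨n, a⟩ ⟨m, b⟩ h
    obtain ⟨h1, h2⟩ := Prod.mk.inj h
    exact Prod.ext (add_right_cancel h1) ((Equiv.swap q p).injective h2)
  obtain ⟨U, hU, hUv⟩ := exists_isometry
    (orthonormal_smul_bvec (χ := fun _ => 1) (by simp) he)
  obtain ⟨W, hW, hWv⟩ := exists_isometry
    (orthonormal_smul_bvec (χ := fun j => if j.2 = q then 1 else -1)
      (by intro j; split_ifs <;> simp) he)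
  refine ⟨(1 / 2 : ℂ) • (U + W), ?_, fun i j => ?_⟩
  · rw [norm_smul]
    have := norm_add_le U W
    norm_num
    linarith
  · rw [ent_smul, ent_add, ent, ent, hUv, hWv, inner_smul_right, inner_smul_right, inner_bvec_bvec]
    by_cases hq : j.2 = q
    · have hiff : i = e j ↔ (i.1 - j.1, i.2, j.2) = (d, p, q) := by
        simp only [e, hq, Equiv.swap_apply_left, Prod.ext_iff, Prod.fst_sub, Prod.snd_sub,
          Prod.fst_add, Prod.snd_add]
        constructor
        · rintro ⟨⟨h1, h2⟩, h3⟩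
          exact ⟨⟨by omega, by omega⟩, h3, by simp⟩
        · rintro ⟨⟨h1, h2⟩, h3, -⟩
          exact ⟨⟨by omega, by omega⟩, h3⟩
      rw [if_pos hq]
      simp only [hiff]
      split_ifs <;> norm_num
    · rw [if_neg hq, if_neg (c := (i.1 - j.1, i.2, j.2) = (d, p, q))]
      · ring
      · intro h
        exact hq (congrArg (fun x => x.2.2) h)

/-- Summable coefficients define a bounded periodic operator. -/
lemma exists_of_summable (h : Coeff → ℂ) (hs : Summable fun d => ‖h d‖) :
    ∃ A : Op, ‖A‖ ≤ ∑' d, ‖h d‖ ∧ ∀ i j, ent A i j = h (i.1 - j.1, i.2, j.2) := by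
  choose U hU hUe using exists_elementary
  have hb : ∀ d, ‖h d • U d‖ ≤ ‖h d‖ := fun d => by
    rw [norm_smul]
    exact mul_le_of_le_one_right (norm_nonneg _) (hU d)
  have hsum : Summable fun d => h d • U d := Summable.of_norm_bounded hs hb
  refine ⟨∑' d, h d • U d, tsum_of_norm_bounded hs.hasSum hb, fun i j => ?_⟩
  have h1 := hsum.hasSum.mapL (entCLM i j)
  have h2 : HasSum (fun d => entCLM i j (h d • U d)) (h (i.1 - j.1, i.2, j.2)) := by
    convert hasSum_ite_eq (i.1 - j.1, i.2, j.2) (h (i.1 - j.1, i.2, j.2)) using 2 with d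
    rw [entCLM_apply, ent_smul, hUe]
    by_cases hd : (i.1 - j.1, i.2, j.2) = d
    · subst hd; simp
    · simp [hd, Ne.symm hd]
  exact h1.unique h2

/-- The `ℓ¹`-norm of a cell index. -/
def cnorm (n : ℤ × ℤ) : ℝ := |(n.1 : ℝ)| + |(n.2 : ℝ)|

lemma cnorm_nonneg (n : ℤ × ℤ) : 0 ≤ cnorm n := add_nonneg (abs_nonneg _) (abs_nonneg _)

lemma summable_exp_neg_mul_cnorm {r : ℝ} (hr : 0 < r) :
    Summable fun d : Coeff => Real.exp (-(r * cnorm d.1)) := by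
  have h1 : Summable fun n : ℤ => Real.exp (-(r * |(n : ℝ)|)) := by
    have h0 : Summable fun n : ℕ => Real.exp (-(r * (n : ℝ))) := by
      have : (fun n : ℕ => Real.exp (-(r * (n : ℝ)))) = fun n : ℕ => Real.exp (n * -r) := by
        funext n; congr 1; ring
      rw [this]
      exact Real.summable_exp_nat_mul_iff.2 (by linarith)
    refine Summable.of_nat_of_neg ?_ ?_
    · simpa using h0
    · simpa using h0
  have h2 : Summable fun n : ℤ × ℤ => Real.exp (-(r * cnorm n)) := by
    have := h1.mul_of_nonneg h1 (fun _ => (Real.exp_pos _).le) (fun _ => (Real.exp_pos _).le)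
    refine this.congr fun n => ?_
    rw [← Real.exp_add, cnorm]
    congr 1; ring
  have h3 : Summable fun _ : (Fin 2 × Fin 2) × (Fin 2 × Fin 2) => (1 : ℝ) := Summable.of_finite
  refine (h2.mul_of_nonneg h3 (fun _ => (Real.exp_pos _).le) (fun _ => zero_le_one)).congr ?_
  intro d
  simp

lemma isShortRange_iff {A : Op} : IsShortRange A ↔
    ∃ C r : ℝ, 0 < C ∧ 0 < r ∧ ∀ i j : Label, ‖ent A i j‖ ≤ C * Real.exp (-(r * cnorm (i.1 - j.1))) := by
  have key : ∀ n m : ℤ × ℤ, ((|n.1 - m.1| + |n.2 - m.2| : ℤ) : ℝ) = cnorm (n - m) := by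
    intro n m; simp [cnorm]
  constructor
  · rintro ⟨C, ξ, hC, hξ, h⟩
    refine ⟨C, ξ⁻¹, hC, inv_pos.2 hξ, fun i j => ?_⟩
    have := h i.1 j.1 i.2.1 j.2.1 i.2.2 j.2.2
    rw [key] at this
    rwa [show -(ξ⁻¹ * cnorm (i.1 - j.1)) = -cnorm (i.1 - j.1) / ξ by ring]
  · rintro ⟨C, r, hC, hr, h⟩
    refine ⟨C, r⁻¹, hC, inv_pos.2 hr, fun n m c c' s s' => ?_⟩
    have := h (n, c, s) (m, c', s')
    rw [key]
    rwa [show -cnorm (n - m) / r⁻¹ = -(r * cnorm (n - m)) by rw [div_inv_eq_mul]; ring]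

/-- The coefficients of a periodic operator. -/
def coeff (A : Op) (d : Coeff) : ℂ := ent A (d.1, d.2.1) (0, d.2.2)

lemma ent_eq_coeff {A : Op} (hA : IsPeriodic A) (i j : Label) :
    ent A i j = coeff A (i.1 - j.1, i.2, j.2) := by
  have := isPeriodic_iff.1 hA j.1 (i.1 - j.1, i.2) (0, j.2)
  simpa [coeff] using this

lemma isPeriodic_of_ent {A : Op} {h : Coeff → ℂ} (hA : ∀ i j, ent A i j = h (i.1 - j.1, i.2, j.2)) :
    IsPeriodic A :=
  isPeriodic_iff.2 fun k i j => by simp [hA]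

/-! ### Derivations -/

/-- The position of the site of a label. -/
def pos (i : Label) (k : Fin 2) : ℝ := (site i.1 i.2.1).1 k

/-- `B` is the commutator of the `k`-th position with `A`, in terms of the matrix elements. -/
def IsDer (k : Fin 2) (A B : Op) : Prop :=
  ∀ i j, ent B i j = ((pos i k - pos j k : ℝ) : ℂ) * ent A i j

lemma pos_eq (i : Label) (k : Fin 2) :
    pos i k = i.1.1 * a₁ k + i.1.2 * a₂ k + (if i.2.1 = 0 then 0 else d₃ k) := by
  rw [pos, site]
  split_ifs <;> simp

lemma abs_pos_sub_le (i j : Label) (k : Fin 2) :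
    |pos i k - pos j k| ≤ 2 * (1 + cnorm (i.1 - j.1)) := by
  have h3 : √3 ≤ 2 := by rw [Real.sqrt_le_left (by norm_num)]; norm_num
  have h30 : 0 ≤ √3 := Real.sqrt_nonneg 3
  have ha1 : |a₁ k| ≤ 2 := by
    fin_cases k <;> simp [a₁, d₂, d₃, abs_le] <;> constructor <;> linarith
  have ha2 : |a₂ k| ≤ 2 := by
    fin_cases k <;> simp [a₂, d₁, d₃, abs_le] <;> constructor <;> linarith
  have hd : |(if i.2.1 = 0 then 0 else d₃ k) - (if j.2.1 = 0 then 0 else d₃ k)| ≤ 2 := by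
    fin_cases k <;> split_ifs <;> simp [d₃]
  have e : pos i k - pos j k = ((i.1.1 : ℝ) - j.1.1) * a₁ k + ((i.1.2 : ℝ) - j.1.2) * a₂ k +
      ((if i.2.1 = 0 then 0 else d₃ k) - (if j.2.1 = 0 then 0 else d₃ k)) := by
    rw [pos_eq, pos_eq]; ring
  rw [e]
  refine (abs_add_three _ _ _).trans ?_
  rw [abs_mul, abs_mul, cnorm]
  simp only [Prod.fst_sub, Prod.snd_sub]
  push_cast
  have h1 := mul_le_mul_of_nonneg_left ha1 (abs_nonneg ((i.1.1 : ℝ) - j.1.1))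
  have h2 := mul_le_mul_of_nonneg_left ha2 (abs_nonneg ((i.1.2 : ℝ) - j.1.2))
  linarith

/-- The factor from the positions grows linearly in the cell distance and is absorbed by half of the
decay rate. -/
lemma exists_isDer {A : Op} (hA : IsPeriodic A) (hsr : IsShortRange A) (k : Fin 2) :
    ∃ B, IsDer k A B ∧ IsPeriodic B ∧ IsShortRange B := by
  obtain ⟨C, r, hC, hr, h⟩ := isShortRange_iff.1 hsr
  let f : Coeff → ℂ := fun d =>
    ((pos (d.1, d.2.1) k - pos (0, d.2.2) k : ℝ) : ℂ) * coeff A d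
  have hpos : ∀ i j : Label, pos i k - pos j k = pos (i.1 - j.1, i.2) k - pos (0, j.2) k := by
    intro i j
    simp only [pos_eq, Prod.fst_sub, Prod.snd_sub, Prod.fst_zero, Prod.snd_zero]
    push_cast
    ring
  have hf : ∀ d, ‖f d‖ ≤ (2 * (1 + 2 / r) * C) * Real.exp (-(r / 2 * cnorm d.1)) := by
    intro d
    have h1 := abs_pos_sub_le (d.1, d.2.1) (0, d.2.2) k
    have h2 := h (d.1, d.2.1) (0, d.2.2)
    simp only [sub_zero] at h1 h2
    have h0 := cnorm_nonneg d.1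
    have h3 : 1 + cnorm d.1 ≤ (1 + 2 / r) * Real.exp (r / 2 * cnorm d.1) := by
      have e1 := Real.add_one_le_exp (r / 2 * cnorm d.1)
      have e2 : cnorm d.1 = 2 / r * (r / 2 * cnorm d.1) := by field_simp
      have e3 : 0 < 2 / r := by positivity
      have e4 : 0 ≤ r / 2 * cnorm d.1 := by positivity
      nlinarith
    have h4 : Real.exp (r / 2 * cnorm d.1) * Real.exp (-(r * cnorm d.1)) =
        Real.exp (-(r / 2 * cnorm d.1)) := by
      rw [← Real.exp_add]; congr 1; ring
    simp only [f, norm_mul, Complex.norm_real, Real.norm_eq_abs]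
    calc _ ≤ (2 * (1 + cnorm d.1)) * (C * Real.exp (-(r * cnorm d.1))) := by
          refine mul_le_mul h1 h2 (norm_nonneg _) (by positivity)
      _ ≤ (2 * ((1 + 2 / r) * Real.exp (r / 2 * cnorm d.1))) * (C * Real.exp (-(r * cnorm d.1))) := by
          gcongr
      _ = 2 * (1 + 2 / r) * C * (Real.exp (r / 2 * cnorm d.1) * Real.exp (-(r * cnorm d.1))) := by
          ring
      _ = _ := by rw [h4]
  have hs : Summable fun d => ‖f d‖ :=
    Summable.of_nonneg_of_le (fun _ => norm_nonneg _) hf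
      ((summable_exp_neg_mul_cnorm (half_pos hr)).mul_left _)
  obtain ⟨B, -, hB⟩ := exists_of_summable f hs
  refine ⟨B, fun i j => ?_, isPeriodic_of_ent hB, ?_⟩
  · rw [hB, hpos i j, ent_eq_coeff hA]
  · exact isShortRange_iff.2 ⟨2 * (1 + 2 / r) * C, r / 2, by positivity, half_pos hr, fun i j => by
      rw [hB]; exact hf _⟩

/-! ### Conjugation with exponential weights -/

/-- The pairing of a weight with a cell index. -/
def wt (θ : ℝ × ℝ) (n : ℤ × ℤ) : ℝ := θ.1 * n.1 + θ.2 * n.2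

lemma wt_add (θ : ℝ × ℝ) (n m : ℤ × ℤ) : wt θ (n + m) = wt θ n + wt θ m := by
  simp [wt]; ring

lemma abs_wt_le {θ : ℝ × ℝ} {r : ℝ} (h1 : |θ.1| ≤ r) (h2 : |θ.2| ≤ r) (n : ℤ × ℤ) :
    |wt θ n| ≤ r * cnorm n := by
  refine (abs_add_le _ _).trans ?_
  rw [abs_mul, abs_mul, cnorm, mul_add]
  gcongr

/-- The pairs of operators `(A, e^{θ n} A e^{-θ n})`, in terms of the matrix elements. -/
def conjGraph (θ : ℝ × ℝ) : Subalgebra ℂ (Op × Op) where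
  carrier := {p | ∀ i j, ent p.2 i j = (Real.exp (wt θ (i.1 - j.1)) : ℂ) * ent p.1 i j}
  mul_mem' {p q} hp hq i k := by
    have h1 := hasSum_ent p.2 q.2 i k
    have h2 := (hasSum_ent p.1 q.1 i k).mul_left (Real.exp (wt θ (i.1 - k.1)) : ℂ)
    -- The weights of consecutive cell differences multiply, so the product formula is preserved
    -- term by term.
    refine h1.unique (h2.congr_fun fun j => ?_)
    rw [hp, hq, ← sub_add_sub_cancel i.1 j.1 k.1, wt_add, Real.exp_add]
    push_cast
    ring
  add_mem' {p q} hp hq i j := by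
    simp only [Prod.snd_add, Prod.fst_add, ent_add]
    rw [hp, hq]
    ring
  algebraMap_mem' c i j := by
    simp only [Algebra.algebraMap_eq_smul_one, Prod.smul_snd, Prod.smul_fst, Prod.fst_one,
      Prod.snd_one, ent_smul, ent_one]
    by_cases h : i = j
    · subst h; simp [wt]
    · simp [h]

lemma mem_conjGraph {θ : ℝ × ℝ} {p : Op × Op} : p ∈ conjGraph θ ↔
    ∀ i j, ent p.2 i j = (Real.exp (wt θ (i.1 - j.1)) : ℂ) * ent p.1 i j := Iff.rfl

lemma isClosed_conjGraph (θ : ℝ × ℝ) : IsClosed (conjGraph θ : Set (Op × Op)) := by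
  have : (conjGraph θ : Set (Op × Op)) = ⋂ i : Label, ⋂ j : Label,
      {p | entCLM i j p.2 = (Real.exp (wt θ (i.1 - j.1)) : ℂ) * entCLM i j p.1} := by
    ext p
    simp only [Set.mem_iInter]
    rfl
  rw [this]
  refine isClosed_iInter fun i => isClosed_iInter fun j => isClosed_eq ?_ ?_
  · exact (entCLM i j).continuous.comp continuous_snd
  · exact continuous_const.mul ((entCLM i j).continuous.comp continuous_fst)

lemma abs_exp_sub_one_le_mul (y : ℝ) : |Real.exp y - 1| ≤ |y| * Real.exp |y| := by
  rcases le_total 0 y with h | h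
  · have h1 := Real.add_one_le_exp (-y)
    have h2 : Real.exp (-y) * Real.exp y = 1 := by rw [← Real.exp_add]; simp
    have h3 := Real.exp_pos y
    have h4 := Real.one_le_exp h
    rw [abs_of_nonneg (by linarith), abs_of_nonneg h]
    nlinarith
  · have h1 := Real.add_one_le_exp y
    have h4 := Real.exp_le_one_iff.2 h
    have h5 := Real.one_le_exp (abs_nonneg y)
    rw [abs_of_nonpos (by linarith)]
    have h6 : -y ≤ |y| := neg_le_abs y
    nlinarith [abs_nonneg y]

/-- The coefficients of A' - A are those of A times e^{θ·d} - 1, which is small for small θ up to a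
mild exponential growth that the decay of A absorbs. -/
lemma exists_conj_close {A : Op} (hA : IsPeriodic A) (hsr : IsShortRange A) {ε : ℝ} (hε : 0 < ε) :
    ∃ r > 0, ∀ θ : ℝ × ℝ, |θ.1| ≤ r → |θ.2| ≤ r →
      ∃ A', (A, A') ∈ conjGraph θ ∧ ‖A' - A‖ ≤ ε := by
  obtain ⟨C, r, hC, hr, h⟩ := isShortRange_iff.1 hsr
  have hS := summable_exp_neg_mul_cnorm (half_pos hr)
  set S := ∑' d : Coeff, Real.exp (-(r / 2 * cnorm d.1)) with hSdef
  have hS0 : 0 ≤ S := tsum_nonneg fun _ => (Real.exp_pos _).le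
  set M := 4 / r * C * S + 1 with hM
  have hM0 : 0 < M := by positivity
  -- One quarter of the rate r pays for the weight, another for the linear factor, and r/2 remains
  -- for summability. The bound ε/M makes the sum at most ε.
  refine ⟨min (r / 4) (ε / M), by positivity, fun θ h1 h2 => ?_⟩
  set ρ := min (r / 4) (ε / M) with hρ
  have hρ0 : 0 < ρ := by positivity
  let f : Coeff → ℂ := fun d => ((Real.exp (wt θ d.1) - 1 : ℝ) : ℂ) * coeff A d
  have hf : ∀ d, ‖f d‖ ≤ (ρ * (4 / r) * C) * Real.exp (-(r / 2 * cnorm d.1)) := by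
    intro d
    have hc0 := cnorm_nonneg d.1
    have e0 := abs_wt_le h1 h2 d.1
    have e1 : |Real.exp (wt θ d.1) - 1| ≤ (ρ * cnorm d.1) * Real.exp (r / 4 * cnorm d.1) := by
      refine (abs_exp_sub_one_le_mul _).trans ?_
      refine mul_le_mul e0 (Real.exp_le_exp.2 (e0.trans ?_)) (Real.exp_pos _).le (by positivity)
      exact mul_le_mul_of_nonneg_right (min_le_left _ _) hc0
    have e2 : cnorm d.1 ≤ 4 / r * Real.exp (r / 4 * cnorm d.1) := by
      have h5 := Real.add_one_le_exp (r / 4 * cnorm d.1)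
      have h6 : cnorm d.1 = 4 / r * (r / 4 * cnorm d.1) := by field_simp
      have h7 : 0 < 4 / r := by positivity
      nlinarith
    have e3 := h (d.1, d.2.1) (0, d.2.2)
    simp only [sub_zero] at e3
    have e4 : Real.exp (r / 4 * cnorm d.1) * Real.exp (r / 4 * cnorm d.1) *
        Real.exp (-(r * cnorm d.1)) = Real.exp (-(r / 2 * cnorm d.1)) := by
      rw [← Real.exp_add, ← Real.exp_add]; congr 1; ring
    simp only [f, norm_mul, Complex.norm_real, Real.norm_eq_abs]
    calc _ ≤ ((ρ * cnorm d.1) * Real.exp (r / 4 * cnorm d.1)) *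
            (C * Real.exp (-(r * cnorm d.1))) :=
          mul_le_mul e1 e3 (norm_nonneg _) (by positivity)
      _ ≤ ((ρ * (4 / r * Real.exp (r / 4 * cnorm d.1))) * Real.exp (r / 4 * cnorm d.1)) *
            (C * Real.exp (-(r * cnorm d.1))) := by gcongr
      _ = ρ * (4 / r) * C * (Real.exp (r / 4 * cnorm d.1) * Real.exp (r / 4 * cnorm d.1) *
            Real.exp (-(r * cnorm d.1))) := by ring
      _ = _ := by rw [e4]
  have hs : Summable fun d => ‖f d‖ :=
    Summable.of_nonneg_of_le (fun _ => norm_nonneg _) hf (hS.mul_left _)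
  obtain ⟨B, hB, hBe⟩ := exists_of_summable f hs
  refine ⟨A + B, mem_conjGraph.2 fun i j => ?_, ?_⟩
  · simp only [ent_add]
    rw [hBe, ent_eq_coeff hA i j]
    simp only [f]
    push_cast
    ring
  · rw [add_sub_cancel_left]
    refine hB.trans ((hs.tsum_le_tsum hf (hS.mul_left _)).trans ?_)
    rw [tsum_mul_left, ← hSdef]
    have h8 : ρ ≤ ε / M := min_le_right _ _
    rw [le_div_iff₀ hM0] at h8
    have : ρ * (4 / r) * C * S = ρ * M - ρ := by rw [hM]; ring
    linarith

/-- Boundedness of the conjugations with all weights of size at most `r`. -/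
def HasConj (A : Op) (r : ℝ) : Prop :=
  ∀ θ : ℝ × ℝ, |θ.1| ≤ r → |θ.2| ≤ r → ∃ A', (A, A') ∈ conjGraph θ

/-- The four weights (±r, ±r) suffice: for each cell difference n one of them pairs with n to r|n|₁,
and boundedness of that conjugate is the decay estimate. -/
lemma HasConj.isShortRange {A : Op} {r : ℝ} (hr : 0 < r) (h : HasConj A r) : IsShortRange A := by
  have habs : ∀ s : Bool, |(if s then r else -r)| ≤ r := by
    intro s; split_ifs <;> simp [abs_of_pos hr]
  choose F hF using fun p : Bool × Bool =>
    h (if p.1 then r else -r, if p.2 then r else -r) (habs _) (habs _)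
  refine isShortRange_iff.2 ⟨∑ p, ‖F p‖ + 1, r, by positivity, hr, fun i j => ?_⟩
  set n := i.1 - j.1 with hn
  have hsign : ∀ x : ℤ, ∃ s : Bool, (if s then r else -r) * (x : ℝ) = r * |(x : ℝ)| := by
    intro x
    rcases le_total 0 (x : ℝ) with hx | hx
    · exact ⟨true, by simp [abs_of_nonneg hx]⟩
    · exact ⟨false, by simp [abs_of_nonpos hx]⟩
  obtain ⟨s, hs⟩ := hsign n.1
  obtain ⟨t, ht⟩ := hsign n.2
  have h1 := hF (s, t) i j
  have h2 : wt (if s then r else -r, if t then r else -r) n = r * cnorm n := by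
    rw [wt, cnorm, mul_add, ← hs, ← ht]
  simp only [← hn, h2] at h1
  have h3 : ent A i j = (Real.exp (-(r * cnorm n)) : ℂ) * ent (F (s, t)) i j := by
    rw [h1, ← mul_assoc, ← Complex.ofReal_mul, ← Real.exp_add]
    simp
  rw [h3, norm_mul, Complex.norm_real, Real.norm_of_nonneg (Real.exp_pos _).le, mul_comm]
  gcongr
  have := Finset.single_le_sum (f := fun p => ‖F p‖) (fun p _ => norm_nonneg _)
    (Finset.mem_univ (s, t))
  have := norm_ent_le (F (s, t)) i j
  linarith

lemma HasConj.mono {A : Op} {r r' : ℝ} (h : HasConj A r) (hr : r' ≤ r) : HasConj A r' :=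
  fun θ h1 h2 => h θ (h1.trans hr) (h2.trans hr)

/-! ### The algebra of local operators and its stability under series and Sylvester equations. -/

/-- Periodic short-range operators. -/
structure IsLocal (A : Op) : Prop where
  periodic : IsPeriodic A
  shortRange : IsShortRange A

lemma IsLocal.exists_hasConj {A : Op} (h : IsLocal A) : ∃ r > 0, HasConj A r := by
  obtain ⟨r, hr, H⟩ := exists_conj_close h.periodic h.shortRange one_pos
  exact ⟨r, hr, fun θ h1 h2 => (H θ h1 h2).imp fun _ => And.left⟩

lemma IsLocal.mul {A B : Op} (hA : IsLocal A) (hB : IsLocal B) : IsLocal (A * B) := by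
  obtain ⟨r, hr, h⟩ := hA.exists_hasConj
  obtain ⟨s, hs, h'⟩ := hB.exists_hasConj
  refine ⟨fun γ => (hA.periodic γ).mul_left (hB.periodic γ),
    HasConj.isShortRange (lt_min hr hs) fun θ h1 h2 => ?_⟩
  obtain ⟨A', hA'⟩ := h.mono (min_le_left r s) θ h1 h2
  obtain ⟨B', hB'⟩ := h'.mono (min_le_right r s) θ h1 h2
  have hmem := (conjGraph θ).mul_mem hA' hB'
  rw [Prod.mk_mul_mk] at hmem
  exact ⟨A' * B', hmem⟩

lemma IsLocal.add {A B : Op} (hA : IsLocal A) (hB : IsLocal B) : IsLocal (A + B) := by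
  obtain ⟨r, hr, h⟩ := hA.exists_hasConj
  obtain ⟨s, hs, h'⟩ := hB.exists_hasConj
  refine ⟨fun γ => (hA.periodic γ).add_left (hB.periodic γ),
    HasConj.isShortRange (lt_min hr hs) fun θ h1 h2 => ?_⟩
  obtain ⟨A', hA'⟩ := h.mono (min_le_left r s) θ h1 h2
  obtain ⟨B', hB'⟩ := h'.mono (min_le_right r s) θ h1 h2
  have hmem := (conjGraph θ).add_mem hA' hB'
  rw [Prod.mk_add_mk] at hmem
  exact ⟨A' + B', hmem⟩

lemma IsLocal.smul {A : Op} (hA : IsLocal A) (c : ℂ) : IsLocal (c • A) := by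
  obtain ⟨r, hr, h⟩ := hA.exists_hasConj
  refine ⟨fun γ => (hA.periodic γ).smul_left c, HasConj.isShortRange hr fun θ h1 h2 => ?_⟩
  obtain ⟨A', hA'⟩ := h θ h1 h2
  exact ⟨c • A', (conjGraph θ).smul_mem hA' c⟩

lemma IsLocal.sub {A B : Op} (hA : IsLocal A) (hB : IsLocal B) : IsLocal (A - B) := by
  have := hA.add (hB.smul (-1))
  rwa [neg_one_smul, ← sub_eq_add_neg] at this

lemma isLocal_one : IsLocal 1 :=
  ⟨fun _ => Commute.one_left _, HasConj.isShortRange one_pos fun θ _ _ =>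
    ⟨1, (conjGraph θ).one_mem⟩⟩

/-- A strict norm bound survives conjugation by a small weight, so a contraction argument valid for
F is valid for its conjugates. -/
lemma IsLocal.exists_conj_lt {F : Op} (hF : IsLocal F) {ρ : ℝ} (hρ : ‖F‖ < ρ) :
    ∃ r > 0, ∀ θ : ℝ × ℝ, |θ.1| ≤ r → |θ.2| ≤ r → ∃ F', (F, F') ∈ conjGraph θ ∧ ‖F'‖ < ρ := by
  obtain ⟨r, hr, h⟩ := exists_conj_close hF.periodic hF.shortRange
    (half_pos (sub_pos.2 hρ))
  refine ⟨r, hr, fun θ h1 h2 => ?_⟩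
  obtain ⟨F', hF', hn⟩ := h θ h1 h2
  refine ⟨F', hF', ?_⟩
  have := norm_add_le (F' - F) F
  rw [sub_add_cancel] at this
  linarith

/-- A power series with radius of convergence `1` maps local contractions to local operators. -/
lemma isLocal_of_series {A X S : Op} {b : ℕ → ℝ} (hA : IsLocal A) (hX : IsLocal X) (hX1 : ‖X‖ < 1)
    (hb : ∀ r : ℝ, 0 ≤ r → r < 1 → Summable fun n => |b n| * r ^ n)
    (hlim : Filter.Tendsto (fun N => A * ∑ n ∈ Finset.range N, (b n : ℂ) • X ^ n)
      Filter.atTop (𝓝 S)) (hS : IsPeriodic S) : IsLocal S := by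
  refine ⟨hS, ?_⟩
  obtain ⟨r, hr, h⟩ := hA.exists_hasConj
  obtain ⟨s, hs, h'⟩ := hX.exists_conj_lt hX1
  refine HasConj.isShortRange (lt_min hr hs) fun θ h1 h2 => ?_
  obtain ⟨A', hA'⟩ := h.mono (min_le_left r s) θ h1 h2
  obtain ⟨X', hX', hn⟩ := h' θ (h1.trans (min_le_right r s)) (h2.trans (min_le_right r s))
  have hsum : Summable fun n => (b n : ℂ) • X' ^ n := by
    refine Summable.of_norm_bounded (hb ‖X'‖ (norm_nonneg _) hn) fun n => ?_
    rw [norm_smul, Complex.norm_real, Real.norm_eq_abs]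
    rcases n.eq_zero_or_pos with rfl | hpos
    · have : ‖(1 : Op)‖ ≤ 1 := ContinuousLinearMap.norm_id_le
      simpa using mul_le_of_le_one_right (abs_nonneg (b 0)) this
    · gcongr
      exact norm_pow_le' X' hpos
  have hlim' : Filter.Tendsto (fun N => A' * ∑ n ∈ Finset.range N, (b n : ℂ) • X' ^ n)
      Filter.atTop (𝓝 (A' * ∑' n, (b n : ℂ) • X' ^ n)) :=
    (hsum.hasSum.tendsto_sum_nat).const_mul A'
  -- Each pair of partial sums lies in the graph by the algebra structure, and closedness passes
  -- this to the limit.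
  refine ⟨_, (isClosed_conjGraph θ).mem_of_tendsto (hlim.prodMk_nhds hlim')
    (Filter.Eventually.of_forall fun N => ?_)⟩
  have hmem := (conjGraph θ).mul_mem hA' ((conjGraph θ).sum_mem (t := Finset.range N)
    (f := fun n => (b n : ℂ) • (X, X') ^ n)
    fun n _ => (conjGraph θ).smul_mem ((conjGraph θ).pow_mem hX' n) _)
  have e : (A, A') * ∑ n ∈ Finset.range N, (b n : ℂ) • (X, X') ^ n =
      (A * ∑ n ∈ Finset.range N, (b n : ℂ) • X ^ n,
        A' * ∑ n ∈ Finset.range N, (b n : ℂ) • X' ^ n) := by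
    refine Prod.ext ?_ ?_
    · simp [Prod.fst_sum]
    · simp [Prod.snd_sum]
  rwa [e] at hmem

/-- Solutions of the Sylvester equation with local data are local. -/
lemma isLocal_sylvester {F Y L : Op} {z : ℂ} (hF : IsLocal F) (hY : IsLocal Y)
    (hz : 2 * ‖F‖ < ‖z‖) (h : z • L - F * L - L * F = Y) (hL : IsPeriodic L) : IsLocal L := by
  refine ⟨hL, ?_⟩
  obtain ⟨r, hr, hY'⟩ := hY.exists_hasConj
  obtain ⟨s, hs, hF'⟩ := hF.exists_conj_lt (ρ := ‖z‖ / 2) (by linarith)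
  refine HasConj.isShortRange (lt_min hr hs) fun θ h1 h2 => ?_
  obtain ⟨Y', hY'⟩ := hY'.mono (min_le_left r s) θ h1 h2
  obtain ⟨F', hF', hn⟩ := hF' θ (h1.trans (min_le_right r s)) (h2.trans (min_le_right r s))
  have hz' : 2 * ‖(F, F')‖ < ‖z‖ := by
    rw [Prod.norm_def]
    have := max_lt (show ‖F‖ < ‖z‖ / 2 by linarith) hn
    linarith
  -- The equation is solved for pairs inside the graph; by uniqueness the first component is L, so
  -- the second is its bounded conjugate.
  obtain ⟨⟨M, M'⟩, hM, hMeq⟩ := exists_sylvester (F, F') (Y, Y') z hz'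
    (Subalgebra.toSubmodule (conjGraph θ)) (isClosed_conjGraph θ)
    (fun x hx => ⟨(conjGraph θ).mul_mem hF' hx, (conjGraph θ).mul_mem hx hF'⟩) hY'
  have e1 : z • M - F * M - M * F = Y := congrArg Prod.fst hMeq
  obtain rfl := sylvester_unique hz e1 h
  exact ⟨M', hM⟩

lemma IsLocal.exists_isDer {A : Op} (hA : IsLocal A) (k : Fin 2) : ∃ B, IsDer k A B ∧ IsLocal B := by
  obtain ⟨B, h1, h2, h3⟩ := SpinHall.exists_isDer hA.periodic hA.shortRange k
  exact ⟨B, h1, h2, h3⟩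

lemma isLocal_fermi {H : Op} {μ : ℝ} (hins : IsInsulator H μ) (hH : IsLocal H) :
    IsLocal (fermi H μ) := by
  have hper : IsPeriodic (fermi H μ) := fun γ => commute_fermi (hH.periodic γ)
  obtain ⟨c, r, b, -, -, hr1, hb, hE, -, hlim⟩ := hins.exists_sign_series
  have ha : IsLocal (rescaled H μ c) := (hH.sub (isLocal_one.smul _)).smul _
  have hS : IsLocal (fermiSign H μ) := by
    refine isLocal_of_series ha (isLocal_one.sub (ha.mul ha)) (lt_of_le_of_lt hE hr1) hb hlim ?_
    exact fun γ => (Commute.one_left _).sub_left ((hper γ).smul_left _)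
  have e : fermi H μ = (1 / 2 : ℂ) • (1 - fermiSign H μ) := by
    rw [fermiSign, sub_sub_cancel, smul_smul]
    norm_num
  rw [e]
  exact (isLocal_one.sub hS).smul _

/-! ### The Liouville equation across the gap. -/

lemma IsDer.unique {k : Fin 2} {A B B' : Op} (h : IsDer k A B) (h' : IsDer k A B') : B = B' :=
  ent_ext fun i j => (h i j).trans (h' i j).symm

lemma IsDer.mul {k : Fin 2} {A A' B B' : Op} (hA : IsDer k A A') (hB : IsDer k B B') :
    IsDer k (A * B) (A' * B + A * B') := by
  intro i l
  rw [ent_add]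
  have h1 := (hasSum_ent A' B i l).add (hasSum_ent A B' i l)
  have h2 := (hasSum_ent A B i l).mul_left ((pos i k - pos l k : ℝ) : ℂ)
  refine h1.unique (h2.congr_fun fun j => ?_)
  rw [hA, hB]
  push_cast
  ring

lemma isDer_star {k : Fin 2} {A B : Op} (h : IsDer k A B) : IsDer k (star A) (-star B) := by
  intro i j
  rw [ent_neg, ent_star, ent_star, h, star_mul']
  simp only [Complex.star_def, Complex.conj_ofReal]
  push_cast
  ring

lemma IsDer.star_eq_neg {k : Fin 2} {A B : Op} (h : IsDer k A B) (hA : IsSelfAdjoint A) :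
    star B = -B := by
  have h' := isDer_star h
  rw [hA.star_eq] at h'
  rw [eq_comm, neg_eq_iff_eq_neg]
  exact h.unique h'

/-- The local solutions of a Sylvester equation between two spectral subspaces. -/
lemma exists_local_sylvester {F Y P Q : Op} {z : ℂ} (hF : IsLocal F) (hY : IsLocal Y)
    (hz : 2 * ‖F‖ < ‖z‖) (hFP : Commute F P) (hFQ : Commute F Q) (hQ : Q * Y = Y)
    (hP : Y * P = Y) :
    ∃ L, IsLocal L ∧ z • L - F * L - L * F = Y ∧ Q * L = L ∧ L * P = L := by
  -- Periodicity and the block condition are closed linear conditions stable under multiplication by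
  -- F, so the fixed point can be sought among operators that satisfy them.
  let V : Submodule ℂ Op :=
    { carrier := {X | (∀ γ, X * T γ = T γ * X) ∧ Q * X = X ∧ X * P = X}
      add_mem' := by
        rintro X X' ⟨h1, h2, h3⟩ ⟨h1', h2', h3'⟩
        exact ⟨fun γ => by rw [add_mul, mul_add, h1, h1'], by rw [mul_add, h2, h2'],
          by rw [add_mul, h3, h3']⟩
      zero_mem' := ⟨fun γ => by rw [zero_mul, mul_zero], mul_zero _, zero_mul _⟩
      smul_mem' := by
        rintro c X ⟨h1, h2, h3⟩
        exact ⟨fun γ => by rw [smul_mul_assoc, mul_smul_comm, h1], by rw [mul_smul_comm, h2],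
          by rw [smul_mul_assoc, h3]⟩ }
  have hV : IsClosed (V : Set Op) := by
    have h1 : IsClosed {X : Op | ∀ γ, X * T γ = T γ * X} := by
      rw [Set.ofPred_forall]
      exact isClosed_iInter fun γ => isClosed_eq (by fun_prop) (by fun_prop)
    exact h1.inter ((isClosed_eq (by fun_prop) (by fun_prop)).inter
      (isClosed_eq (by fun_prop) (by fun_prop)))
  obtain ⟨L, ⟨h1, h2, h3⟩, hL⟩ := exists_sylvester F Y z hz V hV (by
    rintro X ⟨h1, h2, h3⟩
    refine ⟨⟨fun γ => ?_, ?_, ?_⟩, fun γ => ?_, ?_, ?_⟩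
    · rw [mul_assoc, h1, ← mul_assoc, (hF.periodic γ).eq, mul_assoc]
    · rw [← mul_assoc, ← hFQ.eq, mul_assoc, h2]
    · rw [mul_assoc, h3]
    · rw [mul_assoc, (hF.periodic γ).eq, ← mul_assoc, h1, mul_assoc]
    · rw [← mul_assoc, h2]
    · rw [mul_assoc, hFP.eq, ← mul_assoc, h3]) ⟨fun γ => (hY.periodic γ).eq, hQ, hP⟩
  exact ⟨L, isLocal_sylvester hF hY hz hL h1, hL, h2, h3⟩

/-- The difference of the solutions at η and 0 solves the equation at 0 with right-hand side -wη
L(η). As L(η) is bounded uniformly, the a priori bound gives O(η). -/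
lemma tendsto_sylvester {F Y : Op} (hF : ‖F‖ < 1) {L : ℝ → Op} (w : ℂ)
    (hL : ∀ η : ℝ, 0 ≤ η → (2 + w * η) • L η - F * L η - L η * F = Y)
    (hw : ∀ η : ℝ, 2 ≤ ‖2 + w * η‖) :
    Filter.Tendsto L (𝓝[>] 0) (𝓝 (L 0)) := by
  have hpos : 0 < 2 - 2 * ‖F‖ := by linarith
  rw [tendsto_iff_norm_sub_tendsto_zero]
  have hbound : ∀ η : ℝ, 0 < η → ‖L η - L 0‖ ≤ η * (‖w‖ * (‖Y‖ / (2 - 2 * ‖F‖)) / (2 - 2 * ‖F‖)) := by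
    intro η hη
    have h1 := norm_sylvester_le (hL η hη.le)
    have h2 : ‖L η‖ ≤ ‖Y‖ / (2 - 2 * ‖F‖) := by
      rw [le_div_iff₀ hpos, mul_comm]
      refine le_trans ?_ h1
      gcongr
      exact hw η
    have h3 : (2 : ℂ) • (L η - L 0) - F * (L η - L 0) - (L η - L 0) * F = -((w * η) • L η) := by
      have e1 := hL η hη.le
      have e0 := hL 0 le_rfl
      rw [Complex.ofReal_zero, mul_zero, add_zero] at e0
      have e2 : (2 : ℂ) • L η - F * L η - L η * F = Y - (w * η) • L η := by
        rw [← e1, add_smul]; abel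
      calc _ = ((2 : ℂ) • L η - F * L η - L η * F) - ((2 : ℂ) • L 0 - F * L 0 - L 0 * F) := by
            rw [smul_sub, mul_sub, sub_mul]; abel
        _ = _ := by rw [e2, e0]; abel
    have h4 := norm_sylvester_le h3
    rw [norm_neg, norm_smul, norm_mul, Complex.norm_real, Real.norm_of_nonneg hη.le] at h4
    have h5 : ‖(2 : ℂ)‖ = 2 := by norm_num
    rw [h5] at h4
    rw [← mul_div_assoc, le_div_iff₀ hpos, mul_comm ‖L η - L 0‖]
    refine h4.trans ?_
    calc ‖w‖ * η * ‖L η‖ ≤ ‖w‖ * η * (‖Y‖ / (2 - 2 * ‖F‖)) := by gcongr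
      _ = _ := by ring
  refine squeeze_zero' (Filter.Eventually.of_forall fun _ => norm_nonneg _)
    (g := fun η : ℝ => η * (‖w‖ * (‖Y‖ / (2 - 2 * ‖F‖)) / (2 - 2 * ‖F‖))) ?_ ?_
  · filter_upwards [self_mem_nhdsWithin] with η hη using hbound η hη
  · have : Filter.Tendsto (fun η : ℝ => η * (‖w‖ * (‖Y‖ / (2 - 2 * ‖F‖)) / (2 - 2 * ‖F‖))) (𝓝 0)
        (𝓝 0) := by
      have h := (continuous_mul_const (‖w‖ * (‖Y‖ / (2 - 2 * ‖F‖)) / (2 - 2 * ‖F‖))).tendsto 0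
      rwa [zero_mul] at h
    exact this.mono_left nhdsWithin_le_nhds

lemma two_le_norm (w : ℂ) (hw : w.re = 0) (η : ℝ) : 2 ≤ ‖2 + w * η‖ := by
  refine le_trans ?_ (Complex.abs_re_le_norm _)
  simp [hw]

/-- The commutator of a position with the Fermi projection is off-diagonal. -/
lemma offdiag_of_isDer {P K : Op} {k : Fin 2} (hP : P * P = P) (hK : IsDer k P K) :
    K = (1 - P) * K * P + P * K * (1 - P) := by
  have h1 : K * P + P * K = K := by
    have := hK.mul hK
    rw [hP] at this
    exact this.unique hK
  -- Compressing the Leibniz rule for P² = P gives PKP = 2 PKP; the other diagonal block then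
  -- vanishes as well.
  have h2 : P * K * P = 0 := by
    have h3 : P * (K * P + P * K) * P = P * K * P := by rw [h1]
    have h4 : P * (K * P + P * K) * P = P * K * (P * P) + (P * P) * K * P := by noncomm_ring
    rw [h4, hP] at h3
    exact left_eq_add.1 h3.symm
  calc K = K * P + P * K - P * K * P - P * K * P := by rw [h2, h1]; abel
    _ = _ := by noncomm_ring

lemma isSelfAdjoint_rescaled {H : Op} (hH : IsSelfAdjoint H) (μ c : ℝ) :
    IsSelfAdjoint (rescaled H μ c) := by
  rw [IsSelfAdjoint, rescaled, star_smul, star_sub, star_smul, star_one, hH.star_eq,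
    Complex.star_def, Complex.conj_ofReal, Complex.conj_ofReal]

/-- The Liouville equation for the commutator of a position with the Fermi projection. -/
lemma exists_liouville {H : Op} {μ : ℝ} (hins : IsInsulator H μ) (hH : IsLocal H) {k : Fin 2}
    {K : Op} (hK : IsDer k (fermi H μ) K) (hKl : IsLocal K) :
    ∃ L : ℝ → Op, (∀ η, 0 ≤ η → IsLocal (L η) ∧
        H * L η - L η * H - (Complex.I * (η : ℂ)) • L η = K) ∧
      Filter.Tendsto L (𝓝[>] 0) (𝓝 (L 0)) ∧ IsSelfAdjoint (L 0) := by
  obtain ⟨c, r, b, hc, -, hr1, -, -, hFr, -⟩ := hins.exists_sign_series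
  set P := fermi H μ with hPdef
  set a := rescaled H μ c with ha
  set S := fermiSign H μ with hS
  set F := 1 - a * S with hF
  have hPP : P * P = P := hins.fermi_mul_fermi
  have hPl : IsLocal P := isLocal_fermi hins hH
  have hSP : S = 1 - (2 : ℂ) • P := rfl
  have hal : IsLocal a := (hH.sub (isLocal_one.smul _)).smul _
  have hSl : IsLocal S := isLocal_one.sub (hPl.smul _)
  have hFl : IsLocal F := isLocal_one.sub (hal.mul hSl)
  have hF1 : ‖F‖ < 1 := lt_of_le_of_lt hFr hr1
  have hPsa : IsSelfAdjoint P := IsInsulator.isSelfAdjoint_fermi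
  have hHP : Commute P H := commute_fermi (Commute.refl H)
  have haP : Commute a P := ((hHP.symm).sub_left ((Commute.one_left P).smul_left _)).smul_left _
  have haS : Commute a S := (Commute.one_right a).sub_right (haP.smul_right _)
  have hPS : Commute S P := (Commute.one_left P).sub_left ((Commute.refl P).smul_left _)
  have hFP : Commute F P := (Commute.one_left P).sub_left (haP.mul_left hPS)
  have hFQ : Commute F (1 - P) := (Commute.one_right F).sub_right hFP
  have hSS : S * S = 1 := by
    rw [hSP]
    simp only [mul_sub, sub_mul, one_mul, mul_one, smul_mul_assoc, mul_smul_comm, hPP]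
    module
  -- Polar decomposition a = |a| sgn a, with |a| = 1 - F.
  have haF : a = (1 - F) * S := by rw [hF, sub_sub_cancel, mul_assoc, hSS, mul_one]
  have hFS : Commute F S := (Commute.one_left S).sub_left (haS.mul_left (Commute.refl S))
  have hasa : IsSelfAdjoint a := isSelfAdjoint_rescaled hins.selfAdjoint μ c
  have hSsa : IsSelfAdjoint S := by
    -- S = -2(P - 1/2) is itself a real affine rescaling of P.
    have := isSelfAdjoint_rescaled (isSelfAdjoint_rescaled hPsa 0 1) (1 / 2) (-1 / 2)
    have e : rescaled (rescaled P 0 1) (1 / 2) (-1 / 2) = S := by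
      rw [hSP, rescaled, rescaled]
      push_cast
      module
    rwa [e] at this
  have hFsa : IsSelfAdjoint F := (IsSelfAdjoint.one _).sub ((hasa.commute_iff hSsa).1 haS)
  have hQP : (1 - P) * P = 0 := by rw [sub_mul, one_mul, hPP, sub_self]
  have hPQ : P * (1 - P) = 0 := by rw [mul_sub, mul_one, hPP, sub_self]
  have hQQ : (1 - P) * (1 - P) = 1 - P := by rw [mul_sub, hQP, mul_one, sub_zero]
  have hQl : IsLocal (1 - P) := isLocal_one.sub hPl
  have hKoff := offdiag_of_isDer hPP hK
  set γ : ℂ := ((c⁻¹ : ℝ) : ℂ) with hγ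
  have hγc : (c : ℂ) * γ = 1 := by
    rw [hγ, ← Complex.ofReal_mul, mul_inv_cancel₀ hc.ne', Complex.ofReal_one]
  set Y₁ := γ • ((1 - P) * K * P) with hY₁
  set Y₂ := -(γ • (P * K * (1 - P))) with hY₂
  have hY₁l : IsLocal Y₁ := ((hQl.mul hKl).mul hPl).smul _
  have hY₂l : IsLocal Y₂ := by
    have := ((hPl.mul hKl).mul hQl).smul (-γ)
    rwa [neg_smul] at this
  -- The term iη divided by c. It is imaginary, so adding it to 2 cannot decrease the modulus, and
  -- the contraction is uniform in η.
  set w : ℂ := Complex.I * γ with hw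
  have hwre : w.re = 0 := by simp [hw, hγ]
  have hz₁ : ∀ η : ℝ, 2 * ‖F‖ < ‖2 + -w * η‖ := fun η =>
    lt_of_lt_of_le (by linarith) (two_le_norm (-w) (by simp [hwre]) η)
  have hz₂ : ∀ η : ℝ, 2 * ‖F‖ < ‖2 + w * η‖ := fun η =>
    lt_of_lt_of_le (by linarith) (two_le_norm w hwre η)
  choose L₁ hL₁l hL₁ hQL₁ hL₁P using fun η : ℝ => exists_local_sylvester hFl hY₁l (hz₁ η) hFP hFQ
    (by rw [hY₁, mul_smul_comm, ← mul_assoc, ← mul_assoc, hQQ])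
    (by rw [hY₁, smul_mul_assoc, mul_assoc, hPP])
  choose L₂ hL₂l hL₂ hPL₂ hL₂Q using fun η : ℝ => exists_local_sylvester hFl hY₂l (hz₂ η) hFQ hFP
    (by rw [hY₂, mul_neg, mul_smul_comm, ← mul_assoc, ← mul_assoc, hPP])
    (by rw [hY₂, neg_mul, smul_mul_assoc, mul_assoc, hQQ])
  -- S acts as +1 on the left of this block and as -1 on the right, which turns the commutator with
  -- a into the anticommutator with 1 - F. On the other block the signs are exchanged.
  have hcomm₁ : ∀ η, a * L₁ η - L₁ η * a = Y₁ + (w * η) • L₁ η := by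
    intro η
    have e1 : S * L₁ η = L₁ η := by
      rw [← hQL₁ η, ← mul_assoc, hSP, sub_mul, one_mul, smul_mul_assoc, hPQ, smul_zero, sub_zero]
    have e2 : L₁ η * S = -L₁ η := by
      rw [hSP, mul_sub, mul_smul_comm, hL₁P, mul_one, two_smul]; abel
    have e3 : a * L₁ η = (1 - F) * L₁ η := by rw [haF, mul_assoc, e1]
    have e4 : L₁ η * a = -(L₁ η * (1 - F)) := by
      rw [haF, ((Commute.one_left S).sub_left hFS).eq, ← mul_assoc, e2, neg_mul]
    rw [e3, e4, ← hL₁ η, add_smul, two_smul, neg_mul, neg_smul, sub_mul, mul_sub, one_mul, mul_one]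
    abel
  have hcomm₂ : ∀ η, a * L₂ η - L₂ η * a = -Y₂ + (w * η) • L₂ η := by
    intro η
    have e1 : S * L₂ η = -L₂ η := by
      rw [hSP, sub_mul, smul_mul_assoc, hPL₂, one_mul, two_smul]; abel
    have e2 : L₂ η * S = L₂ η := by
      rw [← hL₂Q η, mul_assoc, hSP, mul_sub, mul_one, mul_smul_comm, hQP, smul_zero, sub_zero]
    have e3 : a * L₂ η = -((1 - F) * L₂ η) := by rw [haF, mul_assoc, e1, mul_neg]
    have e4 : L₂ η * a = L₂ η * (1 - F) := by
      rw [haF, ((Commute.one_left S).sub_left hFS).eq, ← mul_assoc, e2]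
    rw [e3, e4, ← hL₂ η, add_smul, two_smul, sub_mul, mul_sub, one_mul, mul_one]
    abel
  refine ⟨fun η => L₁ η + L₂ η, fun η _ => ⟨(hL₁l η).add (hL₂l η), ?_⟩, ?_, ?_⟩
  · have hHa : H = (c : ℂ) • a + (μ : ℂ) • 1 := by
      rw [ha, rescaled, smul_smul, hγc, one_smul, sub_add_cancel]
    have e : H * (L₁ η + L₂ η) - (L₁ η + L₂ η) * H = (c : ℂ) • ((a * L₁ η - L₁ η * a) +
        (a * L₂ η - L₂ η * a)) := by
      rw [hHa]
      simp only [add_mul, mul_add, smul_mul_assoc, mul_smul_comm, one_mul, mul_one, smul_add,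
        smul_sub]
      abel
    have e5 : (c : ℂ) * (w * η) = Complex.I * η := by
      rw [hw]; linear_combination (Complex.I * η) * hγc
    rw [e, hcomm₁, hcomm₂]
    simp only [hY₁, hY₂, neg_neg, smul_add, smul_smul, hγc, e5, one_smul]
    nth_rw 3 [hKoff]
    abel
  · exact (tendsto_sylvester hF1 (-w) (fun η _ => hL₁ η)
      (two_le_norm (-w) (by simp [hwre]))).add
      (tendsto_sylvester hF1 w (fun η _ => hL₂ η) (two_le_norm w hwre))
  · have hKs : star K = -K := hK.star_eq_neg hPsa
    have hγs : star γ = γ := by rw [hγ]; simp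
    -- At η = 0 both blocks have the coefficient 2, and K* = -K makes Y₂ the adjoint of Y₁;
    -- uniqueness does the rest.
    have e1 : star (L₁ 0) = L₂ 0 := by
      refine sylvester_unique (hz₂ 0) (Y := Y₂) ?_ (hL₂ 0)
      have h1 := congrArg star (hL₁ 0)
      simp only [hY₁, star_sub, star_smul, star_mul, hFsa.star_eq, hPsa.star_eq, hKs, star_one,
        hγs, Complex.ofReal_zero, mul_zero, add_zero, star_ofNat] at h1 ⊢
      rw [hY₂, sub_right_comm, h1, ← smul_neg]
      congr 1
      noncomm_ring
    change star (L₁ 0 + L₂ 0) = L₁ 0 + L₂ 0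
    rw [star_add, e1, ← e1, star_star, add_comm]

/-! ### Evaluation of unbounded operators -/

/-- The vector `ψ` is in the domain of `A`, and `A ψ = φ`. -/
def Val (A : POp) (ψ φ : Hil) : Prop := ∃ h : ψ ∈ A.domain, A ⟨ψ, h⟩ = φ

lemma val_bdd (A : Op) (ψ : Hil) : Val (bdd A) ψ (A ψ) := ⟨Submodule.mem_top, rfl⟩

lemma Val.pmul {A B : POp} {ψ φ χ : Hil} (hB : Val B ψ φ) (hA : Val A φ χ) :
    Val (pmul A B) ψ χ := by
  obtain ⟨h, rfl⟩ := hB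
  obtain ⟨h', rfl⟩ := hA
  exact ⟨⟨⟨⟨ψ, h⟩, h', rfl⟩, h⟩, rfl⟩

lemma Val.add {A B : POp} {ψ φ χ : Hil} (hA : Val A ψ φ) (hB : Val B ψ χ) :
    Val (A + B) ψ (φ + χ) := by
  obtain ⟨h, rfl⟩ := hA
  obtain ⟨h', rfl⟩ := hB
  exact ⟨⟨h, h'⟩, rfl⟩

lemma Val.sub {A B : POp} {ψ φ χ : Hil} (hA : Val A ψ φ) (hB : Val B ψ χ) :
    Val (A - B) ψ (φ - χ) := by
  obtain ⟨h, rfl⟩ := hA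
  obtain ⟨h', rfl⟩ := hB
  exact ⟨⟨h, h'⟩, LinearPMap.sub_apply _ _ _⟩

lemma Val.smul {A : POp} {ψ φ : Hil} (hA : Val A ψ φ) (c : ℂ) : Val (c • A) ψ (c • φ) := by
  obtain ⟨h, rfl⟩ := hA
  exact ⟨h, rfl⟩

lemma Val.pcomm {A B : POp} {ψ φ φ' χ χ' : Hil} (hB : Val B ψ φ) (hAB : Val A φ χ)
    (hA : Val A ψ φ') (hBA : Val B φ' χ') : Val (pcomm A B) ψ (χ - χ') :=
  (hB.pmul hAB).sub (hA.pmul hBA)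

lemma inner_bvec (n : ℤ × ℤ) (c s : Fin 2) (ψ : Hil) :
    inner ℂ (bvec (n, c, s)) ψ = ψ (site n c) s := inner_δ_left _ _ _

lemma val_X_iff {k : Fin 2} {ψ φ : Hil} :
    Val (X k) ψ φ ↔ ∀ i, inner ℂ (bvec i) φ = (pos i k : ℂ) * inner ℂ (bvec i) ψ := by
  have key : (∀ i, inner ℂ (bvec i) φ = (pos i k : ℂ) * inner ℂ (bvec i) ψ) ↔
      ∀ x : Site, φ x = ((x.1 k : ℝ) : ℂ) • ψ x := by
    constructor
    · intro h x
      obtain ⟨n, c, rfl⟩ := exists_site x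
      ext s
      have := h (n, c, s)
      rw [inner_bvec, inner_bvec] at this
      simpa [pos] using this
    · rintro h ⟨n, c, s⟩
      rw [inner_bvec, inner_bvec, h]
      rfl
  rw [key]
  constructor
  · rintro ⟨h, rfl⟩ x
    rfl
  · intro h
    have hmem : Memℓp (fun x : Site => ((x.1 k : ℝ) : ℂ) • ψ x) 2 := by
      have := lp.memℓp φ
      rwa [show (φ : ∀ _ : Site, Spin) = fun x : Site => ((x.1 k : ℝ) : ℂ) • ψ x from
        funext h] at this
    refine ⟨hmem, ?_⟩
    ext1
    funext x
    exact (h x).symm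

lemma val_X_bvec (k : Fin 2) (j : Label) : Val (X k) (bvec j) ((pos j k : ℂ) • bvec j) := by
  refine val_X_iff.2 fun i => ?_
  rw [inner_smul_right, inner_bvec_bvec]
  split_ifs with h
  · rw [h]
  · simp

/-- A bounded commutator with the position makes A preserve the domain of X, with X A ψ = A X ψ + B
ψ. This settles the domain questions of all products below. -/
lemma IsDer.val_X {k : Fin 2} {A B : Op} (h : IsDer k A B) {ψ φ : Hil} (hψ : Val (X k) ψ φ) :
    Val (X k) (A ψ) (A φ + B ψ) := by
  rw [val_X_iff] at hψ ⊢
  intro i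
  rw [inner_add_right]
  have h1 := (hasSum_ent_mul A i φ).add (hasSum_ent_mul B i ψ)
  have h2 := (hasSum_ent_mul A i ψ).mul_left (pos i k : ℂ)
  refine h1.unique (h2.congr_fun fun j => ?_)
  rw [hψ, h]
  push_cast
  ring

lemma IsDer.val_pcomm_bdd_X {k : Fin 2} {A B : Op} (h : IsDer k A B) {ψ φ : Hil}
    (hψ : Val (X k) ψ φ) : Val (pcomm (bdd A) (X k)) ψ (-(B ψ)) := by
  have := Val.pcomm hψ (val_bdd A φ) (val_bdd A ψ) (h.val_X hψ)
  rwa [sub_add_cancel_left] at this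

lemma IsDer.isBoundedExtension {k : Fin 2} {P K : Op} (h : IsDer k P K) :
    IsBoundedExtension (pcomm (X k) (bdd P)) K := by
  have hval : ∀ ψ φ, Val (X k) ψ φ → Val (pcomm (X k) (bdd P)) ψ (K ψ) := by
    intro ψ φ hψ
    have := Val.pcomm (val_bdd P ψ) (h.val_X hψ) hψ (val_bdd P φ)
    rwa [add_sub_cancel_left] at this
  constructor
  · have hd : Dense (Submodule.span ℂ (Set.range basis) : Set Hil) :=
      Submodule.dense_iff_topologicalClosure_eq_top.2 basis.dense_span
    refine hd.mono ?_
    have : Submodule.span ℂ (Set.range basis) ≤ (pcomm (X k) (bdd P)).domain := by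
      rw [Submodule.span_le]
      rintro _ ⟨j, rfl⟩
      rw [basis_apply]
      exact (hval _ _ (val_X_bvec k j)).1
    exact this
  · refine ⟨le_top, ?_⟩
    rintro ⟨ψ, hψ⟩ ⟨ψ', hψ'⟩ he
    obtain rfl : ψ = ψ' := he
    have hX : ψ ∈ (X k).domain := hψ.2.2
    obtain ⟨_, h2⟩ := hval ψ _ ⟨hX, rfl⟩
    exact h2

lemma isDer_zero_of_diagonal {k : Fin 2} {A : Op} (h : ∀ i j, pos i k ≠ pos j k → ent A i j = 0) :
    IsDer k A 0 := by
  intro i j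
  rw [ent_zero]
  by_cases hij : pos i k = pos j k
  · simp [hij]
  · simp [h i j hij]

/-- The sign of the spin. -/
def spinSign (s : Fin 2) : ℂ := if s = 0 then 1 / 2 else -(1 / 2)

lemma Sz_bvec (i : Label) : Sz (bvec i) = spinSign i.2.2 • bvec i := by
  obtain ⟨n, c, s⟩ := i
  refine twist_bvec (fun t' => ?_) rfl
  fin_cases s <;> fin_cases t' <;> simp [pauliZ, spinSign]

lemma ent_Sz (i j : Label) : ent Sz i j = if i = j then spinSign j.2.2 else 0 := by
  rw [ent, Sz_bvec, inner_smul_right, inner_bvec_bvec]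
  split_ifs <;> simp

lemma isLocal_Sz : IsLocal Sz := by
  constructor
  · refine isPeriodic_iff.2 fun k i j => ?_
    rw [ent_Sz, ent_Sz]
    refine if_congr ?_ rfl rfl
    simp [Prod.ext_iff]
  · refine HasConj.isShortRange one_pos fun θ _ _ => ⟨Sz, mem_conjGraph.2 fun i j => ?_⟩
    rw [ent_Sz]
    split_ifs with h
    · subst h; simp [wt]
    · simp

lemma isSelfAdjoint_Sz : IsSelfAdjoint Sz := by
  refine ent_ext fun i j => ?_
  rw [ent_star, ent_Sz, ent_Sz]
  by_cases h : i = j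
  · subst h
    simp only [if_true, spinSign, Complex.star_def]
    split_ifs <;> simp [map_ofNat]
  · simp [h, Ne.symm h]

lemma isDer_Sz (k : Fin 2) : IsDer k Sz 0 := by
  refine isDer_zero_of_diagonal fun i j h => ?_
  rw [ent_Sz, if_neg]
  rintro rfl
  exact h rfl

/-! ### The spin currents -/

lemma val_Jconv {k : Fin 2} {H V L D : Op} (hV : IsDer k H V) (hD : IsDer k L D) (j : Label) :
    Val (pmul (Jconv H k) (bdd L)) (bvec j)
      ((-(Complex.I / 2) • ((V * Sz + Sz * V) * L)) (bvec j)) := by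
  have hX := hD.val_X (val_X_bvec k j)
  have hXS := (isDer_Sz k).val_X hX
  have h1 := (val_bdd Sz (L (bvec j))).pmul (hV.val_pcomm_bdd_X hXS)
  have h2 := (hV.val_pcomm_bdd_X hX).pmul (val_bdd Sz _)
  have h3 := (h1.smul (Complex.I / 2)).add (h2.smul (Complex.I / 2))
  have h4 := (val_bdd L (bvec j)).pmul h3
  have e : (-(Complex.I / 2) • ((V * Sz + Sz * V) * L)) (bvec j) =
      (Complex.I / 2) • -(V (Sz (L (bvec j)))) + (Complex.I / 2) • Sz (-(V (L (bvec j)))) := by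
    change -(Complex.I / 2) • (V (Sz (L (bvec j))) + Sz (V (L (bvec j)))) = _
    rw [map_neg]
    module
  rw [e]
  exact h4

/-- From V = [X, H] one gets H X S_z = X H S_z - V S_z, so the current is i(X [H, S_z] - V S_z). On
the diagonal the unbounded factor X becomes the number `pos j k`. -/
lemma val_Jprop {k : Fin 2} {H V L D : Op} (hV : IsDer k H V) (hD : IsDer k L D) (j : Label) :
    ∃ χ, Val (pmul (Jprop H k) (bdd L)) (bvec j) χ ∧
      inner ℂ (bvec j) χ = Complex.I * ((pos j k : ℂ) * ent ((H * Sz - Sz * H) * L) j j -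
        ent (V * Sz * L) j j) := by
  have hX := hD.val_X (val_X_bvec k j)
  set φ := L ((pos j k : ℂ) • bvec j) + D (bvec j) with hφ
  have hXS := (isDer_Sz k).val_X hX
  have hXHS := hV.val_X hXS
  have hXH := hV.val_X hX
  have hXSH := (isDer_Sz k).val_X hXH
  have h1 := Val.pcomm ((val_bdd Sz (L (bvec j))).pmul hXS) (val_bdd H _)
    (val_bdd H (L (bvec j))) ((val_bdd Sz _).pmul hXSH)
  refine ⟨_, (val_bdd L (bvec j)).pmul (h1.smul Complex.I), ?_⟩
  have e1 := val_X_iff.1 hXHS j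
  have e2 := val_X_iff.1 hXSH j
  rw [inner_add_right] at e1
  rw [inner_smul_right, inner_sub_right, e2, sub_mul, ent_sub, mul_sub,
    show ent (H * Sz * L) j j = inner ℂ (bvec j) (H (Sz (L (bvec j)))) from rfl,
    show ent (Sz * H * L) j j = inner ℂ (bvec j) (Sz (H (L (bvec j)))) from rfl,
    show ent (V * Sz * L) j j = inner ℂ (bvec j) (V (Sz (L (bvec j)))) from rfl]
  linear_combination Complex.I * e1

/-! ### The trace per unit volume -/

lemma site_mem_cell (k : ℕ) (n : ℤ × ℤ) (c : Fin 2) :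
    site n c ∈ cell (2 * k + 1) ↔ n ∈ Finset.Icc (-(k : ℤ)) k ×ˢ Finset.Icc (-(k : ℤ)) k := by
  obtain ⟨m, n⟩ := n
  have h3 : √3 ≠ 0 := by positivity
  -- d₃ = (a₂ - a₁)/3. As 1/3 < 1/2, a square of odd side 2k + 1 contains exactly the cells with
  -- indices in [-k, k], each with both of its sites.
  set ε : ℝ := if c = 0 then 0 else 1 / 3 with hε
  have hε01 : 0 ≤ ε ∧ ε ≤ 1 / 3 := by rw [hε]; split_ifs <;> norm_num
  have hsite : (site (m, n) c).1 = ((m : ℝ) - ε) • a₁ + ((n : ℝ) + ε) • a₂ := by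
    ext i
    fin_cases c <;> fin_cases i <;> simp [site, a₁, a₂, d₁, d₂, d₃, ε] <;> ring
  have huniq : ∀ α β α' β' : ℝ, α • a₁ + β • a₂ = α' • a₁ + β' • a₂ → α = α' ∧ β = β' := by
    intro α β α' β' h
    have e0 := congrFun h 0
    have e1 := congrFun h 1
    simp [a₁, a₂, d₁, d₂, d₃] at e0 e1
    have e1' : α + β = α' + β' := mul_right_cancel₀ h3 (by linarith)
    constructor <;> linarith
  have hint : ∀ (x : ℤ) (e : ℝ), |e| ≤ 1 / 3 → (|(x : ℝ) + e| ≤ ((2 * k + 1 : ℕ) : ℝ) / 2 ↔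
      -(k : ℤ) ≤ x ∧ x ≤ k) := by
    intro x e he
    rw [abs_le] at he ⊢
    push_cast
    constructor
    · rintro ⟨h1, h2⟩
      constructor
      · have : (-(k : ℤ) - 1 : ℝ) < x := by push_cast; linarith
        have : -(k : ℤ) - 1 < x := by exact_mod_cast this
        omega
      · have : (x : ℝ) < (k : ℤ) + 1 := by push_cast; linarith
        have : x < (k : ℤ) + 1 := by exact_mod_cast this
        omega
    · rintro ⟨h1, h2⟩
      have h1' : -(k : ℝ) ≤ x := by exact_mod_cast h1
      have h2' : (x : ℝ) ≤ k := by exact_mod_cast h2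
      constructor <;> linarith
  have hm := hint m (-ε) (by rw [abs_neg, abs_of_nonneg hε01.1]; exact hε01.2)
  have hn := hint n ε (by rw [abs_of_nonneg hε01.1]; exact hε01.2)
  rw [Finset.mem_product, Finset.mem_Icc, Finset.mem_Icc, ← hm, ← hn]
  constructor
  · rintro ⟨α, β, h, hα, hβ⟩
    rw [hsite] at h
    obtain ⟨rfl, rfl⟩ := huniq _ _ _ _ h
    exact ⟨hα, hβ⟩
  · rintro ⟨h1, h2⟩
    exact ⟨_, _, hsite, h1, h2⟩

lemma sum_cell {M : Type*} [AddCommMonoid M] (k : ℕ) (f : Site → M) :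
    ∑ x ∈ (cell_finite (2 * k + 1)).toFinset, f x =
      ∑ n ∈ Finset.Icc (-(k : ℤ)) k ×ˢ Finset.Icc (-(k : ℤ)) k, ∑ c : Fin 2, f (site n c) := by
  classical
  rw [← Finset.sum_product']
  symm
  refine Finset.sum_bij (fun p _ => site p.1 p.2) ?_ ?_ ?_ ?_
  · rintro ⟨n, c⟩ h
    rw [Finset.mem_product] at h
    rw [Set.Finite.mem_toFinset, site_mem_cell]
    exact h.1
  · rintro ⟨n, c⟩ _ ⟨m, c'⟩ _ h
    obtain ⟨h1, h2⟩ := site_injective h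
    exact Prod.ext h1 h2
  · intro x hx
    obtain ⟨n, c, rfl⟩ := exists_site x
    rw [Set.Finite.mem_toFinset, site_mem_cell] at hx
    exact ⟨(n, c), Finset.mem_product.2 ⟨hx, Finset.mem_univ _⟩, rfl⟩
  · intros; rfl

/-- If the spin trace of the diagonal depends on the sublattice only, the trace per unit volume is
its mean over the two sublattices. -/
lemma hasTracePerVolume_of {A : POp} {g : Label → ℂ} {G : Fin 2 → ℂ}
    (hA : ∀ j, ∃ χ, Val A (bvec j) χ ∧ inner ℂ (bvec j) χ = g j)
    (hG : ∀ n c, ∑ s, g (n, c, s) = G c) : HasTracePerVolume A (1 / 2 * ∑ c, G c) := by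
  have hmem : ∀ x s, δ x s ∈ A.domain := by
    intro x s
    obtain ⟨n, c, rfl⟩ := exists_site x
    obtain ⟨χ, h, -⟩ := hA (n, c, s)
    exact h.1
  -- The normalized trace does not depend on k. The factor 1/2 comes from counting two sites per
  -- cell.
  refine ⟨hmem, tendsto_const_nhds.congr fun k => ?_⟩
  have hdiag : ∀ n c s, inner ℂ (δ (site n c) s) (A ⟨δ (site n c) s, hmem _ _⟩) = g (n, c, s) := by
    intro n c s
    obtain ⟨χ, ⟨h, rfl⟩, h2⟩ := hA (n, c, s)
    exact h2
  set N := (Finset.Icc (-(k : ℤ)) k ×ˢ Finset.Icc (-(k : ℤ)) k).card with hN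
  have hcard : ((cell (2 * k + 1)).ncard : ℂ) = N * 2 := by
    rw [Set.ncard_eq_toFinset_card _ (cell_finite _), Finset.card_eq_sum_ones, sum_cell]
    simp [hN]
  have hN0 : (N : ℂ) ≠ 0 := by
    rw [Nat.cast_ne_zero, hN, ← Nat.pos_iff_ne_zero, Finset.card_pos]
    exact ⟨(0, 0), by simp⟩
  rw [hcard, sum_cell]
  simp only [hdiag, hG, Finset.sum_const, ← hN, nsmul_eq_mul]
  field_simp

/-! ### The trace over the fundamental cell -/

/-- The spin trace of the diagonal block at a site of the fundamental cell. -/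
def siteTrace (c : Fin 2) : Op →L[ℂ] ℂ := ∑ s : Fin 2, entCLM (0, c, s) (0, c, s)

lemma siteTrace_apply (c : Fin 2) (A : Op) :
    siteTrace c A = ∑ s, ent A (0, c, s) (0, c, s) := by
  simp [siteTrace, entCLM_apply]

lemma sum_ent_diag {A : Op} (hA : IsPeriodic A) (n : ℤ × ℤ) (c : Fin 2) :
    ∑ s, ent A (n, c, s) (n, c, s) = siteTrace c A := by
  rw [siteTrace_apply]
  refine Finset.sum_congr rfl fun s _ => ?_
  simpa using isPeriodic_iff.1 hA n (0, c, s) (0, c, s)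

/-- The trace over the fundamental cell. -/
def cellTrace (A : Op) : ℂ := ∑ c, siteTrace c A

lemma cellTrace_eq (A : Op) : cellTrace A = ∑ p : Fin 2 × Fin 2, ent A (0, p) (0, p) := by
  rw [Fintype.sum_prod_type]
  simp only [cellTrace, siteTrace_apply]

lemma hasSum_cellTrace (A B : Op) :
    HasSum (fun m : ℤ × ℤ => ∑ q : Fin 2 × Fin 2, ∑ p : Fin 2 × Fin 2,
      ent A (0, p) (m, q) * ent B (m, q) (0, p)) (cellTrace (A * B)) := by
  rw [cellTrace_eq]
  have h : HasSum (fun j : (ℤ × ℤ) × (Fin 2 × Fin 2) => ∑ p : Fin 2 × Fin 2,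
      ent A (0, p) j * ent B j (0, p)) (∑ p : Fin 2 × Fin 2, ent (A * B) (0, p) (0, p)) :=
    hasSum_sum fun p _ => hasSum_ent A B (0, p) (0, p)
  exact h.prod_fiberwise fun m => hasSum_fintype _

/-- Cyclicity: translating by -m brings the intermediate cell m back to 0, which matches the two
sums after m ↦ -m. -/
lemma cellTrace_mul_comm {A B : Op} (hA : IsPeriodic A) (hB : IsPeriodic B) :
    cellTrace (A * B) = cellTrace (B * A) := by
  have h1 := hasSum_cellTrace A B
  have h2 := (Equiv.neg (ℤ × ℤ)).hasSum_iff.2 (hasSum_cellTrace B A)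
  refine h1.unique (h2.congr_fun fun m => ?_)
  rw [Finset.sum_comm]
  refine Finset.sum_congr rfl fun q _ => Finset.sum_congr rfl fun p _ => ?_
  have e1 := isPeriodic_iff.1 hA m (-m, q) (0, p)
  have e2 := isPeriodic_iff.1 hB m (0, p) (-m, q)
  simp only [neg_add_cancel, zero_add] at e1 e2
  simp only [Equiv.neg_apply]
  rw [← e1, ← e2, mul_comm]

lemma cellTrace_im_eq_zero {A B : Op} (hA : IsPeriodic A) (hB : IsPeriodic B)
    (hAs : IsSelfAdjoint A) (hBs : IsSelfAdjoint B) : (cellTrace (A * B)).im = 0 := by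
  have h : star (cellTrace (A * B)) = cellTrace (star (A * B)) := by
    simp only [cellTrace_eq, star_sum, ent_star]
  rw [star_mul, hAs.star_eq, hBs.star_eq, cellTrace_mul_comm hB hA] at h
  exact Complex.conj_eq_iff_im.1 h

/-! ### Symmetries -/

/-- An operator that permutes the canonical basis up to phases, mapping each sublattice to itself,
the spin being permuted by `π`. -/
structure IsMonomial (U : Op) (e : Equiv.Perm Label) (u : Label → ℂ) (π : Equiv.Perm (Fin 2)) :
    Prop where
  map_bvec : ∀ i, U (bvec i) = u i • bvec (e i)
  norm_phase : ∀ i, ‖u i‖ = 1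
  snd : ∀ i, (e i).2 = (i.2.1, π i.2.2)

namespace IsMonomial

variable {U : Op} {e : Equiv.Perm Label} {u : Label → ℂ} {π : Equiv.Perm (Fin 2)}

lemma phase_ne_zero (h : IsMonomial U e u π) (i : Label) : u i ≠ 0 := by
  intro h0
  have := h.norm_phase i
  simp [h0] at this

lemma star_bvec (h : IsMonomial U e u π) (i : Label) :
    (star U) (bvec (e i)) = star (u i) • bvec i := by
  refine eq_of_inner_bvec fun j => ?_
  rw [ContinuousLinearMap.star_eq_adjoint, ContinuousLinearMap.adjoint_inner_right, h.map_bvec,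
    inner_smul_left, inner_smul_right, inner_bvec_bvec, inner_bvec_bvec]
  by_cases hji : j = i
  · subst hji; simp
  · simp [hji]

lemma star_mul_self (h : IsMonomial U e u π) : star U * U = 1 := by
  refine clm_ext fun j => ?_
  rw [mul_apply_eq_comp, h.map_bvec, map_smul, h.star_bvec, smul_smul, Complex.star_def,
    Complex.mul_conj', h.norm_phase]
  simp

lemma mul_star_self (h : IsMonomial U e u π) : U * star U = 1 := by
  refine clm_ext fun j => ?_
  obtain ⟨i, rfl⟩ := e.surjective j
  rw [mul_apply_eq_comp, h.star_bvec, map_smul, h.map_bvec, smul_smul, Complex.star_def,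
    Complex.conj_mul', h.norm_phase]
  simp

lemma ent_mul_left (h : IsMonomial U e u π) (A : Op) (i j : Label) :
    ent (U * A) (e i) j = u i * ent A i j := by
  rw [ent, mul_apply_eq_comp, ← ContinuousLinearMap.adjoint_inner_left,
    ← ContinuousLinearMap.star_eq_adjoint, h.star_bvec, inner_smul_left, ent]
  simp

lemma ent_mul_right (h : IsMonomial U e u π) (A : Op) (i j : Label) :
    ent (A * U) i j = u j * ent A i (e j) := by
  rw [ent, mul_apply_eq_comp, h.map_bvec, map_smul, inner_smul_right, ent]

lemma intertwine_iff (h : IsMonomial U e u π) {A A' : Op} :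
    A' * U = U * A ↔ ∀ i j, u j * ent A' (e i) (e j) = u i * ent A i j := by
  constructor
  · intro hA i j
    rw [← h.ent_mul_left, ← hA, h.ent_mul_right]
  · intro hA
    refine ent_ext fun i j => ?_
    obtain ⟨i, rfl⟩ := e.surjective i
    rw [h.ent_mul_left, h.ent_mul_right, hA]

/-- Phases cancel on the diagonal, π only permutes the spin sum, and periodicity brings the image
site back to cell 0. That U preserves the sublattices is essential. -/
lemma siteTrace_eq (h : IsMonomial U e u π) {A A' : Op} (hA : A' * U = U * A)
    (hper : IsPeriodic A') (c : Fin 2) : siteTrace c A' = siteTrace c A := by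
  rw [siteTrace_apply c A, siteTrace_apply, ← Equiv.sum_comp π]
  refine Finset.sum_congr rfl fun s _ => ?_
  have h1 := mul_left_cancel₀ (h.phase_ne_zero _) (h.intertwine_iff.1 hA (0, c, s) (0, c, s))
  rw [← h1]
  have h2 : e (0, c, s) = (0 + (e (0, c, s)).1, c, π s) := by
    rw [zero_add]
    exact Prod.ext rfl (h.snd _)
  rw [h2]
  exact (isPeriodic_iff.1 hper _ (0, c, π s) (0, c, π s)).symm

/-- Covariance of the derivations. -/
lemma isDer_intertwine (h : IsMonomial U e u π) {O : Fin 2 → Fin 2 → ℝ}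
    (hO : ∀ i k, pos (e i) k = ∑ l, O k l * pos i l) {A : Op} (hA : Commute A U)
    {B : Fin 2 → Op} (hB : ∀ k, IsDer k A (B k)) (k : Fin 2) :
    B k * U = U * ∑ l, (O k l : ℂ) • B l := by
  refine h.intertwine_iff.2 fun i j => ?_
  rw [ent_sum, hB, hO, hO]
  simp only [ent_smul, hB _ i j]
  have := h.intertwine_iff.1 hA.eq i j
  push_cast
  simp only [Fin.sum_univ_two]
  linear_combination ((O k 0 : ℂ) * (pos i 0 - pos j 0) + O k 1 * (pos i 1 - pos j 1)) * this

/-- Covariance of the solutions of the Liouville equation. -/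
lemma liouville_intertwine (h : IsMonomial U e u π) {O : Fin 2 → Fin 2 → ℝ} {H : Op}
    (hH : IsSelfAdjoint H) (hU : Commute H U) {η : ℝ} (hη : 0 < η) {K L : Fin 2 → Op}
    (hK : ∀ k, K k * U = U * ∑ l, (O k l : ℂ) • K l)
    (hL : ∀ k, H * L k - L k * H - (Complex.I * (η : ℂ)) • L k = K k) (k : Fin 2) :
    L k * U = U * ∑ l, (O k l : ℂ) • L l := by
  set M := ∑ l, (O k l : ℂ) • L l with hM
  have hUs : Commute H (star U) := by
    have := congrArg (fun X => star U * X * star U) hU.eq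
    simp only [mul_assoc, h.mul_star_self, mul_one] at this
    rw [← mul_assoc (star U) U, h.star_mul_self, one_mul] at this
    exact this.symm
  have hMK : H * M - M * H - (Complex.I * (η : ℂ)) • M = ∑ l, (O k l : ℂ) • K l := by
    simp only [hM, ← hL, Fin.sum_univ_two, mul_add, add_mul, mul_smul_comm, smul_mul_assoc]
    module
  -- U M U* solves the equation that defines L k. Both equal the same time integral, which is where
  -- η > 0 enters.
  have hsol : H * (U * M * star U) - U * M * star U * H -
      (Complex.I * (η : ℂ)) • (U * M * star U) = K k := by
    calc _ = U * (H * M - M * H - (Complex.I * (η : ℂ)) • M) * star U := by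
          rw [← mul_assoc, ← mul_assoc, hU.eq, mul_assoc _ (star U), ← hUs.eq]
          simp only [mul_sub, sub_mul, mul_assoc, mul_smul_comm, smul_mul_assoc]
      _ = K k := by rw [hMK, ← hK, mul_assoc, h.mul_star_self, mul_one]
  have hfin := (linearResponse_eq hH hη (hL k)).symm.trans (linearResponse_eq hH hη hsol)
  rw [hfin, mul_assoc, h.star_mul_self, mul_one]

end IsMonomial

/-! ### The rotation and the reflection in the canonical basis. -/

/-- The index of the sublattice as an integer. -/
def sublatticeIndex (c : Fin 2) : ℤ := if c = 0 then 0 else 1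

lemma a₃_eq : a₃ = -a₁ - a₂ := by
  simp only [a₁, a₂, a₃]; abel

lemma rotSite_site (n : ℤ × ℤ) (c : Fin 2) :
    rotSite (site n c) = site (-n.2, n.1 - n.2 - sublatticeIndex c) c := by
  apply Subtype.ext
  have hd : rot d₃ = d₃ - a₂ := by rw [sub_eq_add_neg, ← rot_d₃]; abel
  simp only [rotSite, Equiv.coe_fn_mk, site, map_add, map_zsmul, rot_a₁, rot_a₂, a₃_eq, sublatticeIndex]
  split_ifs
  · rw [map_zero]; module
  · rw [hd]; module

lemma reflSite_site (n : ℤ × ℤ) (c : Fin 2) : reflSite (site n c) = site (-n.2, -n.1) c := by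
  apply Subtype.ext
  have hd : refl d₃ = d₃ := sub_eq_zero.1 refl_d₃
  simp only [reflSite, Equiv.coe_fn_mk, site, map_add, map_zsmul, refl_a₁, refl_a₂]
  split_ifs
  · rw [map_zero]; module
  · rw [hd]; module

/-- The action of the rotation on the labels. -/
def rotLabel : Equiv.Perm Label where
  toFun i := ((-i.1.2, i.1.1 - i.1.2 - sublatticeIndex i.2.1), i.2)
  invFun i := ((i.1.2 - i.1.1 + sublatticeIndex i.2.1, -i.1.1), i.2)
  left_inv i := by ext <;> simp; ring
  right_inv i := by ext <;> simp; ring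

/-- The action of the reflection on the labels. -/
def reflLabel : Equiv.Perm Label where
  toFun i := ((-i.1.2, -i.1.1), (i.2.1, Equiv.swap 0 1 i.2.2))
  invFun i := ((-i.1.2, -i.1.1), (i.2.1, Equiv.swap 0 1 i.2.2))
  left_inv i := by ext <;> simp
  right_inv i := by ext <;> simp

lemma isMonomial_Rrot : IsMonomial Rrot rotLabel
    (fun i => if i.2.2 = 0 then Complex.exp (-(Complex.I * (Real.pi / 3)))
      else Complex.exp (Complex.I * (Real.pi / 3))) (Equiv.refl _) := by
  refine ⟨?_, ?_, fun i => rfl⟩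
  · rintro ⟨n, c, s⟩
    refine twist_bvec (fun t' => ?_) (rotSite_site n c)
    fin_cases s <;> fin_cases t' <;> simp
  · intro i
    have h1 : Complex.I * (Real.pi / 3) = ((Real.pi / 3 : ℝ) : ℂ) * Complex.I := by
      push_cast; ring
    split_ifs
    · rw [h1, ← neg_mul, ← Complex.ofReal_neg, Complex.norm_exp_ofReal_mul_I]
    · rw [h1, Complex.norm_exp_ofReal_mul_I]

lemma isMonomial_Rvh : IsMonomial Rvh reflLabel (fun i => if i.2.2 = 0 then 1 else -1)
    (Equiv.swap 0 1) := by
  refine ⟨?_, ?_, fun i => rfl⟩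
  · rintro ⟨n, c, s⟩
    refine twist_bvec (fun t' => ?_) (reflSite_site n c)
    fin_cases s <;> fin_cases t' <;> simp [pauliY]
  · intro i
    split_ifs <;> simp

/-- The matrix of the rotation. -/
def rotMat : Fin 2 → Fin 2 → ℝ := ![![-(1 / 2), -(√3 / 2)], ![√3 / 2, -(1 / 2)]]

/-- The matrix of the reflection. -/
def reflMat : Fin 2 → Fin 2 → ℝ := ![![1, 0], ![0, -1]]

lemma pos_rotLabel (i : Label) (k : Fin 2) : pos (rotLabel i) k = ∑ l, rotMat k l * pos i l := by
  have : pos (rotLabel i) k = rot (site i.1 i.2.1).1 k :=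
    (congrFun (congrArg Subtype.val (rotSite_site i.1 i.2.1)) k).symm
  rw [this, rot_apply]
  fin_cases k <;> simp [rotMat, pos] <;> ring

lemma pos_reflLabel (i : Label) (k : Fin 2) :
    pos (reflLabel i) k = ∑ l, reflMat k l * pos i l := by
  have : pos (reflLabel i) k = refl (site i.1 i.2.1).1 k :=
    (congrFun (congrArg Subtype.val (reflSite_site i.1 i.2.1)) k).symm
  rw [this, refl_apply]
  fin_cases k <;> simp [reflMat, pos]

lemma Sz_mul_Rrot : Sz * Rrot = Rrot * Sz := by
  refine clm_ext fun j => ?_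
  simp only [mul_apply_eq_comp, isMonomial_Rrot.map_bvec, Sz_bvec, map_smul]
  rw [smul_comm]
  rfl

/-- The reflection flips the spin; this is the source of the extra sign in the covariance of the
spin current. -/
lemma Sz_mul_Rvh : Sz * Rvh = -(Rvh * Sz) := by
  refine clm_ext fun j => ?_
  have hs : spinSign (Equiv.swap 0 1 j.2.2) = -spinSign j.2.2 := by
    obtain ⟨n, c, s⟩ := j
    fin_cases s <;> simp [spinSign]
  change Sz (Rvh (bvec j)) = -(Rvh (Sz (bvec j)))
  simp only [isMonomial_Rvh.map_bvec, Sz_bvec, map_smul]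
  rw [smul_comm, ← neg_smul, ← hs]
  rfl

/-! ### Covariant tensors and invariant vectors. -/

/-- Covariance of the site traces of products under a symmetry that maps the spin to `κ` times
itself. -/
lemma IsMonomial.siteTrace_mul_eq {U : Op} {e : Equiv.Perm Label} {u : Label → ℂ}
    {π : Equiv.Perm (Fin 2)} (h : IsMonomial U e u π) {O : Fin 2 → Fin 2 → ℝ} {κ : ℂ}
    {J L : Fin 2 → Op} (hJ : ∀ k, J k * U = κ • (U * ∑ l, (O k l : ℂ) • J l))
    (hL : ∀ k, L k * U = U * ∑ l, (O k l : ℂ) • L l)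
    (hJp : ∀ k, IsPeriodic (J k)) (hLp : ∀ k, IsPeriodic (L k)) (c : Fin 2) (i j : Fin 2) :
    siteTrace c (J i * L j) =
      κ * ∑ k, ∑ l, (O i k : ℂ) * O j l * siteTrace c (J k * L l) := by
  have h1 : (J i * L j) * U =
      U * (κ • ((∑ k, (O i k : ℂ) • J k) * ∑ l, (O j l : ℂ) • L l)) := by
    rw [mul_assoc, hL, ← mul_assoc, hJ, smul_mul_assoc, mul_assoc, mul_smul_comm]
  rw [h.siteTrace_eq h1 (fun γ => (hJp i γ).mul_left (hLp j γ)) c, map_smul, smul_eq_mul]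
  congr 1
  simp only [Fin.sum_univ_two, add_mul, mul_add, smul_mul_assoc, mul_smul_comm, map_add, map_smul,
    smul_eq_mul]
  ring

lemma sqrt_three_mul_self_complex : ((√3 : ℝ) : ℂ) * ((√3 : ℝ) : ℂ) = 3 := by
  rw [← Complex.ofReal_mul, Real.mul_self_sqrt (by norm_num)]
  norm_num

lemma sqrt_three_complex_ne_zero : ((√3 : ℝ) : ℂ) ≠ 0 := by
  rw [Complex.ofReal_ne_zero]
  positivity

/-- A tensor that is covariant under the rotation, and is mapped to its negative by the
reflection, is antisymmetric. -/
lemma antisymm_of_covariant {t : Fin 2 → Fin 2 → ℂ}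
    (hrot : ∀ i j, t i j = 1 * ∑ k, ∑ l, (rotMat i k : ℂ) * rotMat j l * t k l)
    (hrefl : ∀ i j, t i j = (-1) * ∑ k, ∑ l, (reflMat i k : ℂ) * reflMat j l * t k l) :
    t 0 0 = 0 ∧ t 1 1 = 0 ∧ t 1 0 = -t 0 1 := by
  have h0 : t 0 0 = 0 := by
    have := hrefl 0 0
    simp [reflMat, Fin.sum_univ_two] at this
    linear_combination (1 / 2) * this
  have h1 : t 1 1 = 0 := by
    have := hrefl 1 1
    simp [reflMat, Fin.sum_univ_two] at this
    linear_combination (1 / 2) * this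
  refine ⟨h0, h1, ?_⟩
  have := hrot 0 0
  simp [rotMat, Fin.sum_univ_two, h0, h1] at this
  have h3 : ((√3 : ℝ) : ℂ) * (t 1 0 + t 0 1) = 0 := by linear_combination (-4) * this
  have h4 := (mul_eq_zero.1 h3).resolve_left sqrt_three_complex_ne_zero
  linear_combination h4

/-- 1 is not an eigenvalue of the rotation by 2π/3. Used for the mean spin torque. -/
lemma eq_zero_of_rot_invariant {x : Fin 2 → ℂ} (h : ∀ j, x j = ∑ l, (rotMat j l : ℂ) * x l)
    (j : Fin 2) : x j = 0 := by
  have h0 := h 0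
  have h1 := h 1
  have h3 := sqrt_three_mul_self_complex
  simp [rotMat, Fin.sum_univ_two] at h0 h1
  have hx1 : x 1 = 0 := by
    linear_combination (1 / 2) * h1 + (((√3 : ℝ) : ℂ) / 6) * h0 - (1 / 12) * x 1 * h3
  have hx0 : x 0 = 0 := by
    rw [hx1] at h0
    linear_combination (2 / 3) * h0
  fin_cases j
  · exact hx0
  · exact hx1

end SpinHall

/-! ### Proof of the theorem. -/

open SpinHall in
theorem proposition3p9 (H : SpinHall.Op) (μ : ℝ) (hins : SpinHall.IsInsulator H μ)
    (hsr : SpinHall.IsShortRange H) (hAII : SpinHall.IsAIIHex H) :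
    ∃ σ : Matrix (Fin 2) (Fin 2) ℝ,
      (∀ i j, SpinHall.IsResponseCoefficient H μ (SpinHall.Jconv H i) j (σ i j)) ∧
      (∀ i j, SpinHall.IsResponseCoefficient H μ (SpinHall.Jprop H i) j (σ i j)) ∧
      σ = !![0, σ 0 1; -σ 0 1, 0] := by
  have hH : IsLocal H := ⟨hAII.periodic, hsr⟩
  have hHs := hins.selfAdjoint
  choose K hK hKl using fun j => (isLocal_fermi hins hH).exists_isDer j
  choose V hV hVl using fun i => hH.exists_isDer i
  choose L hL hLlim hLsa using fun j => exists_liouville hins hH (hK j) (hKl j)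
  set J : Fin 2 → Op := fun i => V i * Sz + Sz * V i with hJ
  have hJl : ∀ i, IsLocal (J i) := fun i => ((hVl i).mul isLocal_Sz).add (isLocal_Sz.mul (hVl i))
  have hresp : ∀ j (η : ℝ), 0 < η → linearResponse H (K j) η = L j η := fun j η hη =>
    linearResponse_eq hHs hη (hL j η hη.le).2
  -- covariance
  have hVrot := isMonomial_Rrot.isDer_intertwine pos_rotLabel hAII.rotation hV
  have hVrefl := isMonomial_Rvh.isDer_intertwine pos_reflLabel hAII.reflection hV
  have hKrot := isMonomial_Rrot.isDer_intertwine pos_rotLabel (commute_fermi hAII.rotation) hK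
  have hKrefl := isMonomial_Rvh.isDer_intertwine pos_reflLabel (commute_fermi hAII.reflection) hK
  have hLrot : ∀ η : ℝ, 0 < η → ∀ k, L k η * Rrot = Rrot * ∑ l, (rotMat k l : ℂ) • L l η :=
    fun η hη => isMonomial_Rrot.liouville_intertwine hHs hAII.rotation hη hKrot
      fun k => (hL k η hη.le).2
  have hLrefl : ∀ η : ℝ, 0 < η → ∀ k, L k η * Rvh = Rvh * ∑ l, (reflMat k l : ℂ) • L l η :=
    fun η hη => isMonomial_Rvh.liouville_intertwine hHs hAII.reflection hη hKrefl
      fun k => (hL k η hη.le).2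
  have hJrot : ∀ k, J k * Rrot = (1 : ℂ) • (Rrot * ∑ l, (rotMat k l : ℂ) • J l) := by
    intro k
    have e1 : V k * Sz * Rrot = Rrot * (∑ l, (rotMat k l : ℂ) • V l) * Sz := by
      rw [mul_assoc, Sz_mul_Rrot, ← mul_assoc, hVrot]
    have e2 : Sz * V k * Rrot = Rrot * (Sz * ∑ l, (rotMat k l : ℂ) • V l) := by
      rw [mul_assoc, hVrot, ← mul_assoc, Sz_mul_Rrot, mul_assoc]
    rw [hJ, one_smul, add_mul, e1, e2, mul_assoc, ← mul_add]
    simp only [Fin.sum_univ_two, add_mul, mul_add, smul_mul_assoc, mul_smul_comm, smul_add]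
    abel
  have hJrefl : ∀ k, J k * Rvh = (-1 : ℂ) • (Rvh * ∑ l, (reflMat k l : ℂ) • J l) := by
    intro k
    have e1 : V k * Sz * Rvh = -(Rvh * (∑ l, (reflMat k l : ℂ) • V l) * Sz) := by
      rw [mul_assoc, Sz_mul_Rvh, mul_neg, ← mul_assoc, hVrefl]
    have e2 : Sz * V k * Rvh = -(Rvh * (Sz * ∑ l, (reflMat k l : ℂ) • V l)) := by
      rw [mul_assoc, hVrefl, ← mul_assoc, Sz_mul_Rvh, neg_mul, mul_assoc]
    rw [hJ, neg_one_smul, add_mul, e1, e2, mul_assoc, ← neg_add, ← mul_add]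
    simp only [Fin.sum_univ_two, add_mul, mul_add, smul_mul_assoc, mul_smul_comm, smul_add]
    abel
  -- the mean spin torque vanishes at every site
  have htorque : ∀ η : ℝ, 0 < η → ∀ j c, siteTrace c ((H * Sz - Sz * H) * L j η) = 0 := by
    intro η hη j c
    refine eq_zero_of_rot_invariant (x := fun j => siteTrace c ((H * Sz - Sz * H) * L j η)) ?_ j
    intro j
    have hS : Commute Sz Rrot := Sz_mul_Rrot
    -- The torque operator is rotation invariant, so only L carries a vector index.
    have hW : Commute (H * Sz - Sz * H) Rrot :=
      (hAII.rotation.mul_left hS).sub_left (hS.mul_left hAII.rotation)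
    have e : (H * Sz - Sz * H) * L j η * Rrot =
        Rrot * ((H * Sz - Sz * H) * ∑ l, (rotMat j l : ℂ) • L l η) := by
      rw [mul_assoc, hLrot η hη, ← mul_assoc, hW.eq, mul_assoc]
    have hWl : IsLocal (H * Sz - Sz * H) := (hH.mul isLocal_Sz).sub (isLocal_Sz.mul hH)
    rw [isMonomial_Rrot.siteTrace_eq e (hWl.mul (hL j η hη.le).1).periodic]
    simp only [Fin.sum_univ_two, mul_add, mul_smul_comm, map_add, map_smul, smul_eq_mul]
  -- limits of traces
  have hlim : ∀ (A : Op) (z : ℂ) (j : Fin 2), Filter.Tendsto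
      (fun η => (1 / 2 * ∑ c, z * siteTrace c (A * L j η)).re) (𝓝[>] 0)
      (𝓝 (1 / 2 * (z * cellTrace (A * L j 0))).re) := by
    intro A z j
    rw [cellTrace, Finset.mul_sum]
    refine (Complex.continuous_re.tendsto _).comp (Filter.Tendsto.const_mul _
      (tendsto_finsetSum _ fun c _ => Filter.Tendsto.const_mul _ ?_))
    exact ((siteTrace c).continuous.tendsto _).comp ((hLlim j).const_mul A)
  set σ : Matrix (Fin 2) (Fin 2) ℝ :=
    Matrix.of fun i j => (1 / 2 * (-(Complex.I / 2) * cellTrace (J i * L j 0))).re with hσ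
  have hconv : ∀ i j, IsResponseCoefficient H μ (Jconv H i) j (σ i j) := by
    intro i j
    refine ⟨K j, (hK j).isBoundedExtension,
      fun η => 1 / 2 * ∑ c, -(Complex.I / 2) * siteTrace c (J i * L j η), fun η hη => ?_,
      hlim (J i) _ j⟩
    rw [hresp j η hη]
    have hLl := (hL j η hη.le).1
    obtain ⟨D, hD, -⟩ := hLl.exists_isDer i
    refine hasTracePerVolume_of (fun b => ⟨_, val_Jconv (hV i) hD b, rfl⟩) fun n c => ?_
    have := sum_ent_diag (((hJl i).mul hLl).smul (-(Complex.I / 2))).periodic n c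
    rw [map_smul, smul_eq_mul] at this
    exact this
  have hprop : ∀ i j, IsResponseCoefficient H μ (Jprop H i) j (σ i j) := by
    intro i j
    refine ⟨K j, (hK j).isBoundedExtension,
      fun η => 1 / 2 * ∑ c, -Complex.I * siteTrace c (V i * Sz * L j η), fun η hη => ?_, ?_⟩
    · rw [hresp j η hη]
      have hLl := (hL j η hη.le).1
      obtain ⟨D, hD, -⟩ := hLl.exists_isDer i
      refine hasTracePerVolume_of (fun b => val_Jprop (hV i) hD b) fun n c => ?_
      have hWl : IsLocal (H * Sz - Sz * H) := (hH.mul isLocal_Sz).sub (isLocal_Sz.mul hH)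
      have e1 := sum_ent_diag (hWl.mul hLl).periodic n c
      have e2 := sum_ent_diag (((hVl i).mul isLocal_Sz).mul hLl).periodic n c
      rw [htorque η hη j c] at e1
      -- Both spin states sit at the same point, so the position factors out of the spin sum and
      -- multiplies a vanishing torque.
      have hpos : ∀ s, pos (n, c, s) i = pos (n, c, 0) i := fun s => rfl
      simp only [hpos _, ← Finset.mul_sum, Finset.sum_sub_distrib]
      rw [e1, e2]
      ring
    · have h := hlim (V i * Sz) (-Complex.I) j
      convert h using 2
      -- The limits differ by the real part of a multiple of i times the trace of [V, S_z] L(0). V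
      -- is skew-adjoint, so [V, S_z] is self-adjoint and this trace is real.
      have hA : IsSelfAdjoint (V i * Sz - Sz * V i) := by
        have := (hV i).star_eq_neg hHs
        rw [IsSelfAdjoint, star_sub, star_mul, star_mul, this, isSelfAdjoint_Sz.star_eq]
        noncomm_ring
      have him := cellTrace_im_eq_zero
        (((hVl i).mul isLocal_Sz).sub (isLocal_Sz.mul (hVl i))).periodic
        (hL j 0 le_rfl).1.periodic hA (hLsa j)
      have e1 : cellTrace ((V i * Sz - Sz * V i) * L j 0) =
          cellTrace (V i * Sz * L j 0) - cellTrace (Sz * V i * L j 0) := by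
        simp only [cellTrace, sub_mul, map_sub, Finset.sum_sub_distrib]
      have e2 : cellTrace (J i * L j 0) =
          cellTrace (V i * Sz * L j 0) + cellTrace (Sz * V i * L j 0) := by
        simp only [hJ, cellTrace, add_mul, map_add, Finset.sum_add_distrib]
      rw [e1, Complex.sub_im] at him
      rw [hσ, Matrix.of_apply, e2]
      simp
      linarith
  refine ⟨σ, hconv, hprop, ?_⟩
  -- antisymmetry
  have hanti : ∀ η : ℝ, 0 < η → ∀ c,
      siteTrace c (J 0 * L 0 η) = 0 ∧ siteTrace c (J 1 * L 1 η) = 0 ∧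
        siteTrace c (J 1 * L 0 η) = -siteTrace c (J 0 * L 1 η) := fun η hη c =>
    antisymm_of_covariant (t := fun i j => siteTrace c (J i * L j η))
      (isMonomial_Rrot.siteTrace_mul_eq hJrot (hLrot η hη) (fun k => (hJl k).periodic)
        (fun k => (hL k η hη.le).1.periodic) c)
      (isMonomial_Rvh.siteTrace_mul_eq hJrefl (hLrefl η hη) (fun k => (hJl k).periodic)
        (fun k => (hL k η hη.le).1.periodic) c)
  have hdiag : ∀ i, (∀ η : ℝ, 0 < η → ∀ c, siteTrace c (J i * L i η) = 0) → σ i i = 0 := by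
    intro i hi
    -- The covariance identities hold for each η > 0 and are carried to σ by uniqueness of limits.
    refine tendsto_nhds_unique (hlim (J i) (-(Complex.I / 2)) i)
      ((tendsto_const_nhds (x := (0 : ℝ))).congr' ?_)
    filter_upwards [self_mem_nhdsWithin] with η hη
    simp [hi η hη]
  have hoff : σ 1 0 = -σ 0 1 := by
    refine tendsto_nhds_unique (hlim (J 1) (-(Complex.I / 2)) 0)
      ((hlim (J 0) (-(Complex.I / 2)) 1).neg.congr' ?_)
    filter_upwards [self_mem_nhdsWithin] with η hη
    simp only [(hanti η hη _).2.2, mul_neg, Finset.sum_neg_distrib, Complex.neg_re]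
  ext i j
  fin_cases i <;> fin_cases j
  · exact hdiag 0 fun η hη c => (hanti η hη c).1
  · rfl
  · exact hoff
  · exact hdiag 1 fun η hη c => (hanti η hη c).2.1

end
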